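/- **Theorem 1.5 (Multistage pancyclicity game).** Let $b=b(n)$ be a sequence of positive integers which is subpolynomial in $n$, i.e. for every $c>0$ we have $b(n)\le n^{c}$ for all sufficiently large $n$. Then, as $n\to\infty$, $$\tau(\mathcal{PAN}_n,b)=\left(\tfrac12+o(1)\right)\log_{b+1} n .$$ Here $\mathcal{PAN}_n$ is the hypergraph $(\mathcal X,\mathcal F)$ whose board is $\mathcal X=E(K_n)$ and whose winning sets are the edge sets of all pancyclic spanning subgraphs of $K_n$, where a graph on $n$ vertices is pancyclic if it contains a cycle of length $\ell$ for every $3\le \ell\le n$. For a hypergraph $\mathcal H=(\mathcal X,\mathcal F)$ and an integer $b\ge 1$, the $(1:b)$ multistage Maker–Breaker game on $\mathcal H$ is played as follows. Put $\mathcal X_0=\mathcal X$ and $\mathcal F_0=\mathcal F$. In stage $i\ge 1$ the players alternately claim unclaimed elements of $\mathcal X_{i-1}$, where Maker moves first and claims exactly one element in each of her moves, and Breaker claims up to $b$ elements in each of his moves, until every element of $\mathcal X_{i-1}$ is claimed. Then $\mathcal X_i$ is the set of elements claimed by Maker in stage $i$, and $\mathcal F_i=\{F\in\mathcal F_{i-1}: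 F\subseteq \mathcal X_i\}$. The threshold $\tau(\mathcal H,b)$ is the largest $s$ such that Maker has a strategy that ensures $\mathcal F_s\neq\varnothing$; for $\mathcal H=\mathcal{PAN}_n$ this maximum exists for all sufficiently large $n$. -/

import Mathlib

open Filter Topology

namespace MultistageGame

/-- A finite hypergraph `(𝒳, ℱ)`: a finite board together with a family of winning sets,
each of which is a subset of the board. -/
structure GameHypergraph (α : Type) where
  board : Finset α
  winning : Set (Finset α)
  subset_board : ∀ F ∈ winning, F ⊆ board

/-- The hypergraph for the next stage: the board is reduced to the set `M` claimed by Maker, and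
only the winning sets fully contained in `M` are kept. -/
def GameHypergraph.restrict {α : Type} (H : GameHypergraph α) (M : Finset α) :
    GameHypergraph α where
  board := M
  winning := {F | F ∈ H.winning ∧ F ⊆ M}
  subset_board := fun _ hF => hF.2

/-- A position of the multistage game in which Maker is to move (or the current stage is over):
`completed` stages have been played so far, `current` is the hypergraph on which the current
stage is played, and `maker`, `breaker` are the elements of its board which have been claimed
in the current stage by the respective player. -/
structure Position (α : Type) where
  completed : ℕ
  current : GameHypergraph α
  maker : Finset α
  breaker : Finset α

/-- The unclaimed elements of the current board. -/
def Position.free {α : Type} [DecidableEq α] (p : Position α) : Finset α :=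
  p.current.board \ (p.maker ∪ p.breaker)

/-- The starting position of the multistage game on `H`. -/
def Position.start {α : Type} (H : GameHypergraph α) : Position α :=
  ⟨0, H, ∅, ∅⟩

/-- The position after a round in which Maker claims `x` and then Breaker claims the set `S`. -/
def Position.round {α : Type} [DecidableEq α] (p : Position α) (x : α) (S : Finset α) :
    Position α :=
  ⟨p.completed, p.current, insert x p.maker, p.breaker ∪ S⟩

/-- The position at the start of the next stage. -/
def Position.nextStage {α : Type} (p : Position α) : Position α :=
  ⟨p.completed + 1, p.current.restrict p.maker, ∅, ∅⟩

/-- A strategy of Maker tells her which element to claim; it may depend on the current position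
and on the list of all earlier positions (most recent first). -/
abbrev MakerStrategy (α : Type) : Type :=
  List (Position α) → Position α → α

/-- `Play H b σ h p`: in the `(1 : b)` multistage Maker-Breaker game on `H`, if Maker follows `σ`,
then (for suitable moves of Breaker) the position `p` can arise with past positions `h`. -/
inductive Play {α : Type} [DecidableEq α] (H : GameHypergraph α) (b : ℕ) (σ : MakerStrategy α) :
    List (Position α) → Position α → Prop
  | start : Play H b σ [] (Position.start H)
  | round (h : List (Position α)) (p : Position α) (S : Finset α) :
      Play H b σ h p → σ h p ∈ p.free → S ⊆ p.free.erase (σ h p) → S.card ≤ b →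
      Play H b σ (p :: h) (p.round (σ h p) S)
  | nextStage (h : List (Position α)) (p : Position α) :
      Play H b σ h p → p.free = ∅ → Play H b σ (p :: h) p.nextStage

/-- Maker has a strategy in the `(1 : b)` multistage game on `H` which always provides her with a
legal move and ensures `ℱ_s ≠ ∅`, i.e. that some winning set remains after `s` stages, whatever
Breaker does. -/
def MakerCanLast {α : Type} [DecidableEq α] (H : GameHypergraph α) (b s : ℕ) : Prop :=
  ∃ σ : MakerStrategy α,
    (∀ h p, Play H b σ h p → p.free.Nonempty → σ h p ∈ p.free) ∧
    (∀ h p, Play H b σ h p → p.completed = s → p.current.winning.Nonempty)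

/-- The threshold `τ(H, b)`: the largest `s` such that Maker can ensure `ℱ_s ≠ ∅`. -/
noncomputable def tau {α : Type} [DecidableEq α] (H : GameHypergraph α) (b : ℕ) : ℕ :=
  sSup {s : ℕ | MakerCanLast H b s}

/-- A graph on `n` vertices is pancyclic if it contains cycles of all lengths `3, …, n`. -/
def IsPancyclic {n : ℕ} (G : SimpleGraph (Fin n)) : Prop :=
  ∀ l : ℕ, 3 ≤ l → l ≤ n → ∃ (v : Fin n) (c : G.Walk v v), c.IsCycle ∧ c.length = l

/-- The hypergraph `𝒫𝒜𝒩_n`: the board is `E(K_n)`, and the winning sets are the edge sets of the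
pancyclic spanning subgraphs of `K_n`. -/
def PAN (n : ℕ) : GameHypergraph (Sym2 (Fin n)) where
  board := (⊤ : SimpleGraph (Fin n)).edgeFinset
  winning := {F | ∃ G : SimpleGraph (Fin n), IsPancyclic G ∧ (F : Set (Sym2 (Fin n))) = G.edgeSet}
  subset_board := by
    rintro F ⟨G, -, hF⟩ e he
    have h1 : e ∈ G.edgeSet := hF ▸ Finset.mem_coe.2 he
    exact SimpleGraph.mem_edgeFinset.2 (SimpleGraph.edgeSet_mono (le_top : G ≤ ⊤) h1)

/-- `b` is subpolynomial in `n`: `b ≤ n ^ o(1)`, i.e. `b` is eventually below every fixed positive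
power of `n`. -/
def Subpolynomial (b : ℕ → ℕ) : Prop :=
  ∀ c : ℝ, 0 < c → ∀ᶠ n : ℕ in atTop, (b n : ℝ) ≤ (n : ℝ) ^ c

end MultistageGame

/-!
Both bounds on the threshold come from weight functions which a player keeps from growing.

*Maker.* If any two disjoint sets of at least `u` vertices of a graph are joined by an edge and its
minimum degree is at least `20 * u`, then the graph is pancyclic (`IsJoined.isPancyclic`).
Depth-first search finds a path through all but fewer than `2 * u` vertices of any set. Short
cycles consist of a vertex and a path in its neighbourhood. Cycles of medium length leave the
neighbourhood of a vertex, follow a long path outside and return, and the length of the part inside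
the neighbourhood can be chosen so as to hit every total exactly. A cycle that misses fewer than
`15 * u` vertices can be prolonged by one vertex, since among the successors of the neighbours of a
missing vertex two are adjacent. So Maker only has to keep, for a suitable `u`, a share close to
`(b + 1) ^ (-s)` of every star and of every set of edges between two disjoint sets of `u` vertices.
An exponential potential achieves this for every family `𝒜` at once, with a multiplicative loss per
stage arbitrarily close to `b + 1` and an additive loss of order `log 𝒜.card`
(`makerCanLast_of_shares`). With `u = n ^ (1 / 2 - η / 4)`, there are at most `n ^ (3 * u)` sets in
the family, and after `(1 / 2 - η) * log_{b + 1} n` stages the shares still exceed the additive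
loss.

*Breaker.* A pancyclic graph contains a triangle. The Erdős–Selfridge criterion holds over several
stages: in `t` stages Breaker can destroy all sets of a family `𝒜` if
`(b + 1) ^ t * ∑ A ∈ 𝒜, (b + 1) ^ (-t * A.card) < 1` (`Reaches.exists_stages_weight`). There are
about `n ^ (r + 2)` sets of `2 * r` edges on `r + 2` vertices, so for `r` large in terms of `η` all
of them can be destroyed in `(1 / 2 + η) * log_{b + 1} n` stages. Then all clusters of triangles, in
which triangles are connected through common edges, have fewer than `2 * r` edges
(`card_class_lt`). From now on Breaker answers in the cluster in which Maker has played. This halves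
all clusters in each stage, and a bounded number of further stages destroys all triangles
(`not_makerCanLast`). This number is negligible, since `log_{b + 1} n` tends to infinity for
subpolynomial `b`.
-/

namespace MultistageGame

/-! ### Pancyclicity of graphs in which all large sets are joined -/

section Pancyclic

variable {V : Type} {G : SimpleGraph V}

/-- Any two disjoint sets of at least `u` vertices are joined by an edge of `G`. -/
def IsJoined (G : SimpleGraph V) (u : ℕ) : Prop :=
  ∀ U W : Finset V, Disjoint U W → u ≤ U.card → u ≤ W.card → ∃ x ∈ U, ∃ y ∈ W, G.Adj x y

/-- The list `l` of vertices is traversed by a path of `G`. -/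
def IsPathList (G : SimpleGraph V) (l : List V) : Prop :=
  l.Nodup ∧ l.IsChain G.Adj

/-- The list `l` of vertices is traversed by a cycle of `G`; the closing edge runs from the last
vertex to the first one. -/
def IsCycleList (G : SimpleGraph V) (l : List V) : Prop :=
  IsPathList G l ∧ 3 ≤ l.length ∧ ∀ x ∈ l.getLast?, ∀ y ∈ l.head?, G.Adj x y

theorem IsCycleList.exists_walk {l : List V} (h : IsCycleList G l) :
    ∃ (v : V) (c : G.Walk v v), c.IsCycle ∧ c.length = l.length := by
  obtain ⟨⟨hn, hc⟩, h3, hcl⟩ := h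
  have hne : l ≠ [] := by rintro rfl; simp at h3
  have hadj : G.Adj (l.getLast hne) (l.head hne) :=
    hcl _ (List.getLast?_eq_some_getLast hne) _ (List.head?_eq_some_head hne)
  let p := SimpleGraph.Walk.ofSupport l hne hc
  have hsupp : p.support = l := SimpleGraph.Walk.support_ofSupport hne hc
  have hlen : p.length + 1 = l.length := by rw [← SimpleGraph.Walk.length_support, hsupp]
  have hp : p.IsPath := by rw [SimpleGraph.Walk.isPath_def, hsupp]; exact hn
  refine ⟨_, SimpleGraph.Walk.cons hadj p, ?_, by simpa using hlen⟩
  rw [SimpleGraph.Walk.cons_isCycle_iff]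
  refine ⟨hp, fun he => ?_⟩
  have := hp.length_eq_one_of_mem_edges (Sym2.eq_swap ▸ he)
  omega

/-- A state of depth-first search in `G[W]`: `S` is the set of finished vertices, `T` the set of
unvisited ones, and the path `l` is the stack. -/
def IsSearchState (G : SimpleGraph V) (W S T : Finset V) (l : List V) : Prop :=
  IsPathList G l ∧ S ⊆ W ∧ T ⊆ W ∧ Disjoint S T ∧ (∀ x ∈ l, x ∈ W ∧ x ∉ S ∧ x ∉ T) ∧
    S.card + T.card + l.length = W.card ∧ ∀ x ∈ S, ∀ y ∈ T, ¬ G.Adj x y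

/-- Each step of depth-first search raises `2 * S.card + l.length` by exactly one, so that every
value between `0` and `2 * W.card` is attained. -/
theorem exists_searchState [DecidableEq V] (W : Finset V) :
    ∀ k ≤ 2 * W.card, ∃ S T l, IsSearchState G W S T l ∧ 2 * S.card + l.length = k := by
  intro k
  induction k with
  | zero =>
    intro _
    exact ⟨∅, W, [], ⟨⟨by simp, by simp⟩, by simp, by simp, by simp, by simp, by simp, by simp⟩,
      by simp⟩
  | succ k ih =>
    intro hk
    obtain ⟨S, T, l, ⟨⟨hn, hc⟩, hS, hT, hd, hl, hcard, hno⟩, hk'⟩ := ih (by omega)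
    have hd' := Finset.disjoint_left.1 hd
    have push : ∀ t ∈ T, (∀ y ∈ l.head?, G.Adj t y) →
        ∃ S T l, IsSearchState G W S T l ∧ 2 * S.card + l.length = k + 1 := by
      intro t ht hadj
      have htl : t ∉ l := fun h => (hl t h).2.2 ht
      have := Finset.card_erase_of_mem ht
      have : 0 < T.card := Finset.card_pos.2 ⟨t, ht⟩
      refine ⟨S, T.erase t, t :: l, ⟨⟨List.nodup_cons.2 ⟨htl, hn⟩, List.isChain_cons.2 ⟨hadj, hc⟩⟩,
        hS, (Finset.erase_subset _ _).trans hT, hd.mono_right (Finset.erase_subset _ _),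
        ?_, ?_, ?_⟩, ?_⟩
      · intro x hx
        rcases List.mem_cons.1 hx with rfl | hx
        · exact ⟨hT ht, fun h => hd' h ht, by simp⟩
        · exact ⟨(hl x hx).1, (hl x hx).2.1, fun h => (hl x hx).2.2 (Finset.mem_of_mem_erase h)⟩
      · simp only [List.length_cons]; omega
      · exact fun x hx y hy => hno x hx y (Finset.mem_of_mem_erase hy)
      · simp only [List.length_cons]; omega
    rcases l with _ | ⟨x, l⟩
    · obtain ⟨t, ht⟩ : T.Nonempty := by
        rw [← Finset.card_pos]
        simp only [List.length_nil] at hcard hk'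
        omega
      exact push t ht (by simp)
    · by_cases hx : ∃ t ∈ T, G.Adj t x
      · obtain ⟨t, ht, htx⟩ := hx
        exact push t ht (by simpa using htx)
      · push Not at hx
        have hxl := hl x List.mem_cons_self
        have hxS := Finset.card_insert_of_notMem hxl.2.1
        rw [List.nodup_cons] at hn
        simp only [List.length_cons] at hcard hk'
        refine ⟨insert x S, T, l, ⟨⟨hn.2, hc.of_cons⟩, Finset.insert_subset hxl.1 hS, hT, ?_, ?_,
          by omega, ?_⟩, by omega⟩
        · rw [Finset.disjoint_insert_left]; exact ⟨hxl.2.2, hd⟩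
        · intro y hy
          have := hl y (List.mem_cons_of_mem _ hy)
          refine ⟨this.1, ?_, this.2.2⟩
          rw [Finset.mem_insert]
          rintro (rfl | h)
          · exact hn.1 hy
          · exact this.2.1 h
        · intro y hy t ht
          rcases Finset.mem_insert.1 hy with rfl | hy
          · exact fun h => hx t ht h.symm
          · exact hno y hy t ht

/-- Depth-first search, stopped when as many vertices are finished as are unvisited, leaves on its
stack a path through all but fewer than `2 * u` vertices of `W`. -/
theorem IsJoined.exists_path [DecidableEq V] {u : ℕ} (hG : IsJoined G u) (W : Finset V) {k : ℕ}
    (hk : k + 2 * u ≤ W.card) : ∃ l, IsPathList G l ∧ (∀ x ∈ l, x ∈ W) ∧ l.length = k := by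
  obtain ⟨S, T, l, ⟨⟨hn, hc⟩, hS, hT, hd, hl, hcard, hno⟩, hk'⟩ :=
    exists_searchState (G := G) W W.card (by omega)
  have hu : S.card < u := by
    by_contra hu
    obtain ⟨x, hx, y, hy, hxy⟩ := hG S T hd (by omega) (by omega)
    exact hno x hx y hy hxy
  exact ⟨l.take k, ⟨hn.sublist (List.take_sublist _ _), hc.take k⟩,
    fun x hx => (hl x (List.mem_of_mem_take hx)).1, by rw [List.length_take]; omega⟩

theorem IsPathList.reverse {l : List V} (h : IsPathList G l) : IsPathList G l.reverse :=
  ⟨List.nodup_reverse.2 h.1, List.isChain_reverse.2 (h.2.imp fun _ _ h => h.symm)⟩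

theorem IsPathList.infix {l l' : List V} (h : IsPathList G l) (hl : l' <:+: l) :
    IsPathList G l' :=
  ⟨h.1.sublist hl.sublist, h.2.infix hl⟩

/-- From a vertex of a path one can follow the path over at least half of its length in one of the
two directions. -/
theorem IsPathList.exists_from {l : List V} (h : IsPathList G l) {x : V} (hx : x ∈ l) {k : ℕ}
    (hk : 1 ≤ k) (hkl : 2 * k ≤ l.length + 1) :
    ∃ l', IsPathList G (x :: l') ∧ (∀ y ∈ x :: l', y ∈ l) ∧ (x :: l').length = k := by
  obtain ⟨l₁, l₂, rfl⟩ := List.append_of_mem hx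
  simp only [List.length_append, List.length_cons] at hkl
  obtain ⟨k, rfl⟩ : ∃ j, k = j + 1 := ⟨k - 1, by omega⟩
  by_cases hc : k ≤ l₂.length
  · refine ⟨l₂.take k, h.infix ⟨l₁, l₂.drop k, by simp⟩, ?_, by simp [hc]⟩
    intro y hy
    rcases List.mem_cons.1 hy with rfl | hy
    · simp
    · simp [List.mem_of_mem_take hy]
  · have h' := h.reverse
    rw [List.reverse_append, List.reverse_cons, List.append_assoc] at h'
    refine ⟨l₁.reverse.take k, h'.infix ⟨l₂.reverse, l₁.reverse.drop k, by simp⟩, ?_, ?_⟩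
    · intro y hy
      rcases List.mem_cons.1 hy with rfl | hy
      · simp
      · simp [List.mem_reverse.1 (List.mem_of_mem_take hy)]
    · simp; omega

theorem IsPathList.append {l l' : List V} (h : IsPathList G l) (h' : IsPathList G l')
    (hd : ∀ x ∈ l, x ∉ l') (hadj : ∀ x ∈ l.getLast?, ∀ y ∈ l'.head?, G.Adj x y) :
    IsPathList G (l ++ l') :=
  ⟨h.1.append h'.1 (fun x hx hx' => hd x hx hx'), h.2.append h'.2 hadj⟩

/-- If `x` is adjacent to the last vertices of two segments of a cycle whose first successors are
adjacent, then `x` can be inserted into the cycle, the part in between being reversed. -/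
theorem IsCycleList.insert_rotate {l₁ l₂ l₃ : List V} {a a' c c' x : V}
    (h : IsCycleList G (l₁ ++ a :: (l₂ ++ c' :: l₃))) (hx : x ∉ l₁ ++ a :: (l₂ ++ c' :: l₃))
    (hhead : a' ∈ l₂.head?) (hlast : c ∈ l₂.getLast?)
    (hxa : G.Adj x a) (hxc : G.Adj x c) (hac : G.Adj a' c') :
    IsCycleList G (l₁ ++ a :: (x :: l₂.reverse ++ c' :: l₃)) := by
  obtain ⟨⟨hn, hc⟩, h3, hcl⟩ := h
  refine ⟨⟨?_, ?_⟩, ?_, ?_⟩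
  · have hp : (l₁ ++ a :: (x :: l₂.reverse ++ c' :: l₃)).Perm
        (x :: (l₁ ++ a :: (l₂ ++ c' :: l₃))) := by
      have h1 : (l₂.reverse ++ c' :: l₃).Perm (l₂ ++ c' :: l₃) :=
        (List.reverse_perm l₂).append_right _
      calc (l₁ ++ a :: (x :: l₂.reverse ++ c' :: l₃)).Perm
            (l₁ ++ a :: x :: (l₂ ++ c' :: l₃)) :=
              List.Perm.append_left _ (List.Perm.cons _ (List.Perm.cons _ h1))
        _ |>.Perm (x :: (l₁ ++ a :: (l₂ ++ c' :: l₃))) := by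
              refine (List.Perm.append_left _ (List.Perm.swap _ _ _)).trans List.perm_middle
    rw [hp.nodup_iff]
    exact List.nodup_cons.2 ⟨hx, hn⟩
  · rw [List.isChain_append, List.isChain_cons, List.isChain_append] at hc
    obtain ⟨hc1, ⟨-, hc2, hc3, hc4⟩, hc5⟩ := hc
    refine List.isChain_append.2 ⟨hc1, List.isChain_cons.2 ⟨?_, ?_⟩, ?_⟩
    · simpa using hxa.symm
    · refine List.isChain_append.2 ⟨List.isChain_cons.2 ⟨?_, ?_⟩, hc3, ?_⟩
      · rw [List.head?_reverse]
        intro y hy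
        rw [Option.mem_unique hy hlast]; exact hxc
      · exact List.isChain_reverse.2 (hc2.imp fun _ _ h => h.symm)
      · have hne : l₂.reverse ≠ [] := by
          intro h0; rw [List.reverse_eq_nil_iff] at h0; subst h0; simp at hhead
        rw [List.getLast?_cons, List.getLast?_reverse]
        rw [Option.mem_def] at hhead
        rw [hhead]
        simpa using hac
    · simpa using hc5
  · simp at h3 ⊢; omega
  · have e1 : (l₁ ++ a :: (x :: l₂.reverse ++ c' :: l₃)).getLast? =
        (l₁ ++ a :: (l₂ ++ c' :: l₃)).getLast? := by
      simp [List.getLast?_append, List.getLast?_cons]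
    have e2 : (l₁ ++ a :: (x :: l₂.reverse ++ c' :: l₃)).head? =
        (l₁ ++ a :: (l₂ ++ c' :: l₃)).head? := by
      simp [List.head?_append]
    rw [e1, e2]; exact hcl

theorem IsCycleList.exists_insert_of_lt {l : List V} (h : IsCycleList G l) {x : V} (hx : x ∉ l)
    {i j : ℕ} (hij : i < j) (hj : j + 1 < l.length) (hxi : G.Adj x l[i]) (hxj : G.Adj x l[j])
    (hadj : G.Adj l[i + 1] l[j + 1]) :
    ∃ l', IsCycleList G l' ∧ l'.length = l.length + 1 := by
  have hsplit : l = l.take i ++ l[i] :: ((l.drop (i + 1)).take (j - i) ++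
      l[j + 1] :: l.drop (j + 2)) := by
    have h1 : l.drop (i + 1) = (l.drop (i + 1)).take (j - i) ++ l[j + 1] :: l.drop (j + 2) := by
      conv_lhs => rw [← List.take_append_drop (j - i) (l.drop (i + 1))]
      rw [List.drop_drop, show i + 1 + (j - i) = j + 1 by omega, List.drop_eq_getElem_cons hj]
    rw [← h1, ← List.drop_eq_getElem_cons, List.take_append_drop]
  have h' := h
  rw [hsplit] at h' hx
  refine ⟨_, h'.insert_rotate hx (a' := l[i + 1]) (c := l[j]) ?_ ?_ hxi hxj hadj, ?_⟩
  · rw [List.head?_take, if_neg (by omega), List.head?_drop, Option.mem_def,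
      List.getElem?_eq_getElem]
  · rw [Option.mem_def, List.getLast?_eq_getElem?, List.length_take, List.length_drop,
      Nat.min_eq_left (by omega), List.getElem?_take, if_pos (by omega), List.getElem?_drop,
      show i + 1 + (j - i - 1) = j by omega, List.getElem?_eq_getElem]
  · conv_rhs => rw [hsplit]
    simp only [List.length_append, List.length_cons, List.length_reverse]
    omega

/-- A vertex with many neighbours on a cycle can be inserted into it, because two successors of its
neighbours are adjacent. -/
theorem IsCycleList.exists_insert [DecidableEq V] {u : ℕ} (hG : IsJoined G u) {l : List V}
    (h : IsCycleList G l) {x : V} (hx : x ∉ l) {N : Finset V} (hNl : ∀ y ∈ N, y ∈ l)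
    (hN : ∀ y ∈ N, G.Adj x y) (hcard : 2 * u + 1 ≤ N.card) :
    ∃ l', IsCycleList G l' ∧ l'.length = l.length + 1 := by
  have hne : l ≠ [] := by rintro rfl; simpa using h.2.1
  -- The last vertex of `l` is left out since its successor wraps around.
  let N' := N.erase (l.getLast hne)
  have hN' : 2 * u ≤ N'.card := by
    have : N.card - 1 ≤ N'.card := Finset.pred_card_le_card_erase
    omega
  obtain ⟨N₁, hN₁, hc₁⟩ := Finset.exists_subset_card_eq (show u ≤ N'.card by omega)
  have hc₂ : u ≤ (N' \ N₁).card := by rw [Finset.card_sdiff_of_subset hN₁]; omega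
  have hidx : ∀ y ∈ N', l.idxOf y + 1 < l.length := by
    intro y hy
    have hyl := hNl y (Finset.mem_of_mem_erase hy)
    have h1 := List.idxOf_lt_length_of_mem hyl
    by_contra h2
    have h3 : l.idxOf y = l.length - 1 := by omega
    refine Finset.ne_of_mem_erase hy ?_
    rw [List.getLast_eq_getElem]
    simp only [← h3, List.getElem_idxOf]
  let f : V → V := fun y => l.getD (l.idxOf y + 1) x
  have hf : ∀ y (hy : y ∈ N'), f y = l[l.idxOf y + 1]'(hidx y hy) := fun y hy =>
    List.getD_eq_getElem _ _ (hidx y hy)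
  have hinj : ∀ y ∈ N', ∀ z ∈ N', f y = f z → y = z := by
    intro y hy z hz hyz
    rw [hf y hy, hf z hz, h.1.1.getElem_inj_iff] at hyz
    exact (List.idxOf_inj (hNl y (Finset.mem_of_mem_erase hy))).1 (by omega)
  obtain ⟨_, hU, _, hW, hadj⟩ := hG (N₁.image f) ((N' \ N₁).image f)
    (by
      rw [Finset.disjoint_left]
      intro a ha ha'
      obtain ⟨y, hy, rfl⟩ := Finset.mem_image.1 ha
      obtain ⟨z, hz, hzy⟩ := Finset.mem_image.1 ha'
      rw [Finset.mem_sdiff] at hz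
      exact hz.2 (hinj z hz.1 y (hN₁ hy) hzy ▸ hy))
    (by rw [Finset.card_image_of_injOn fun y hy z hz => hinj y (hN₁ hy) z (hN₁ hz)]; omega)
    (by
      rw [Finset.card_image_of_injOn]
      · exact hc₂
      · intro y hy z hz
        exact hinj y (Finset.sdiff_subset hy) z (Finset.sdiff_subset hz))
  obtain ⟨y, hy, rfl⟩ := Finset.mem_image.1 hU
  obtain ⟨z, hz, rfl⟩ := Finset.mem_image.1 hW
  have hy' := hN₁ hy
  have hz' := Finset.sdiff_subset hz
  have hxy := hN y (Finset.mem_of_mem_erase hy')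
  have hxz := hN z (Finset.mem_of_mem_erase hz')
  rw [hf y hy', hf z hz'] at hadj
  have hyi := hidx y hy'
  have hzi := hidx z hz'
  rcases lt_trichotomy (l.idxOf y) (l.idxOf z) with hlt | heq | hlt
  · exact h.exists_insert_of_lt hx hlt hzi (by simpa using hxy) (by simpa using hxz) hadj
  · simp only [heq] at hadj; exact absurd hadj (G.irrefl)
  · exact h.exists_insert_of_lt hx hlt hyi (by simpa using hxz) (by simpa using hxy) hadj.symm

/-- Short cycles: a vertex together with a path in its neighbourhood. -/
theorem IsJoined.exists_short_cycle [DecidableEq V] {u : ℕ} (hG : IsJoined G u) {v : V}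
    {N : Finset V} (hN : ∀ y ∈ N, G.Adj v y) {k : ℕ} (hk : 2 ≤ k) (hkN : k + 2 * u ≤ N.card) :
    ∃ l, IsCycleList G l ∧ l.length = k + 1 := by
  obtain ⟨l, hl, hlN, hlk⟩ := hG.exists_path N hkN
  refine ⟨v :: l, ⟨⟨List.nodup_cons.2 ⟨fun h => G.irrefl (hN v (hlN v h)), hl.1⟩,
    List.isChain_cons.2 ⟨fun y hy => hN y (hlN y (List.mem_of_mem_head? hy)), hl.2⟩⟩, ?_, ?_⟩, ?_⟩
  · simp; omega
  · intro x hx y hy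
    have hlne : l ≠ [] := by rintro rfl; simp at hlk; omega
    rw [List.getLast?_cons, List.getLast?_eq_some_getLast hlne] at hx
    simp at hx hy
    subst hx hy
    exact (hN _ (hlN _ (List.getLast_mem hlne))).symm
  · simp [hlk]

/-- Cycles of medium length `k`: they run from `v` over a path in the neighbourhood `N₁` of `v` and
over a segment of a path `q` outside to another neighbour of `v` in `N₂`. The segment of `q` has
between `k - 3 - 2 * u` and `k - 3` vertices, and the part in `N₁` is chosen to make up for the
difference. -/
theorem IsJoined.exists_medium_cycle [DecidableEq V] {u : ℕ} (hu : 1 ≤ u) (hG : IsJoined G u)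
    {v : V} {N₁ N₂ W : Finset V} (hN₁ : ∀ y ∈ N₁, G.Adj v y) (hN₂ : ∀ y ∈ N₂, G.Adj v y)
    (hd : Disjoint N₁ N₂) (hW₁ : Disjoint N₁ W) (hW₂ : Disjoint N₂ W) (hv : v ∉ W)
    (hc₁ : 6 * u + 2 ≤ N₁.card) (hc₂ : u ≤ N₂.card) {k : ℕ} (hk : 2 * u + 3 ≤ k)
    (hkW : k + 2 * u ≤ W.card + 3) :
    ∃ l, IsCycleList G l ∧ l.length = k := by
  rw [Finset.disjoint_left] at hd hW₁ hW₂
  obtain ⟨q, hq, hqW, hqk⟩ := hG.exists_path W (k := k - 3) (by omega)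
  obtain ⟨r, hr, hrN, hrk⟩ := hG.exists_path N₁ (k := 4 * u + 2) (by omega)
  -- `q₁` and `q₃` are the first and the last `u` vertices of `q`.
  obtain ⟨q₁, q₂, q₃, rfl, hq₁, hq₃⟩ :
      ∃ q₁ q₂ q₃ : List V, q = q₁ ++ q₂ ++ q₃ ∧ q₁.length = u ∧ q₃.length = u := by
    refine ⟨q.take u, (q.drop u).take (q.length - 2 * u), q.drop (q.length - u), ?_, ?_, ?_⟩
    · rw [List.append_assoc]
      conv_lhs => rw [← List.take_append_drop u q,
        ← List.take_append_drop (q.length - 2 * u) (q.drop u), List.drop_drop,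
        show u + (q.length - 2 * u) = q.length - u by omega]
    · rw [List.length_take]; omega
    · rw [List.length_drop]; omega
  have hn := hq.1
  rw [List.nodup_append, List.nodup_append] at hn
  have hr_card : r.toFinset.card = 4 * u + 2 := by rw [List.toFinset_card_of_nodup hr.1, hrk]
  have hq₁_card : q₁.toFinset.card = u := by rw [List.toFinset_card_of_nodup hn.1.1, hq₁]
  have hq₃_card : q₃.toFinset.card = u := by rw [List.toFinset_card_of_nodup hn.2.1, hq₃]
  obtain ⟨x, hx, y, hy, hxy⟩ := hG r.toFinset q₁.toFinset
    (by
      rw [Finset.disjoint_left]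
      intro a ha ha'
      exact hW₁ (hrN a (List.mem_toFinset.1 ha)) (hqW a (by simp_all)))
    (by omega) (by omega)
  obtain ⟨z, hz, w, hw, hzw⟩ := hG N₂ q₃.toFinset
    (by
      rw [Finset.disjoint_left]
      intro a ha ha'
      exact hW₂ ha (hqW a (by simp_all)))
    hc₂ (by omega)
  rw [List.mem_toFinset] at hx hy hw
  obtain ⟨a₁, a₂, rfl⟩ := List.append_of_mem hy
  obtain ⟨b₁, b₂, rfl⟩ := List.append_of_mem hw
  -- The segment of `q` from `y` to `w`.
  set seg := y :: (a₂ ++ q₂ ++ b₁ ++ [w]) with hseg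
  have hsegq : seg <:+: a₁ ++ y :: a₂ ++ q₂ ++ (b₁ ++ w :: b₂) := ⟨a₁, b₂, by simp [hseg]⟩
  have hsegP := hq.infix hsegq
  have hsegW : ∀ t ∈ seg, t ∈ W := fun t ht => hqW t (hsegq.subset ht)
  have hseg_len : seg.length ≤ k - 3 ∧ k - 3 ≤ seg.length + 2 * u := by
    simp only [List.length_append, List.length_cons] at hqk hq₁ hq₃
    simp only [hseg, List.length_append, List.length_cons, List.length_nil]
    omega
  obtain ⟨s, hs, hsr, hsk⟩ := hr.exists_from hx (k := k - 2 - seg.length) (by omega) (by omega)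
  have hsN : ∀ t ∈ x :: s, t ∈ N₁ := fun t ht => hrN t (hsr t ht)
  have hz' : IsPathList G [z] := ⟨by simp, by simp⟩
  have hv' : IsPathList G [v] := ⟨by simp, by simp⟩
  have hP₁ : IsPathList G (seg ++ [z]) := by
    refine hsegP.append hz' (fun t ht ht' => ?_) ?_
    · rw [List.mem_singleton] at ht'
      subst ht'
      exact hW₂ hz (hsegW _ ht)
    · have : seg.getLast? = some w := by
        rw [hseg, ← List.cons_append, List.getLast?_append]; simp
      rw [this]
      simpa using hzw.symm
  have hP₂ : IsPathList G ((x :: s).reverse ++ (seg ++ [z])) := by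
    refine hs.reverse.append hP₁ (fun t ht ht' => ?_) ?_
    · have htN := hsN t (List.mem_reverse.1 ht)
      rcases List.mem_append.1 ht' with ht' | ht'
      · exact hW₁ htN (hsegW t ht')
      · rw [List.mem_singleton] at ht'
        subst ht'
        exact hd htN hz
    · rw [List.getLast?_reverse]
      simpa [hseg] using hxy
  have hP₃ : IsPathList G ([v] ++ ((x :: s).reverse ++ (seg ++ [z]))) := by
    refine hv'.append hP₂ (fun t ht ht' => ?_) ?_
    · rw [List.mem_singleton] at ht
      subst ht
      rcases List.mem_append.1 ht' with ht' | ht'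
      · exact G.irrefl (hN₁ _ (hsN _ (List.mem_reverse.1 ht')))
      · rcases List.mem_append.1 ht' with ht' | ht'
        · exact hv (hsegW _ ht')
        · rw [List.mem_singleton] at ht'
          exact G.irrefl (ht' ▸ hN₂ z hz)
    · intro a ha t ht
      rw [List.getLast?_singleton, Option.mem_some_iff] at ha
      subst ha
      rw [List.head?_append_of_ne_nil _ (by simp)] at ht
      exact hN₁ t (hsN t (List.mem_reverse.1 (List.mem_of_mem_head? ht)))
  refine ⟨_, ⟨hP₃, ?_, ?_⟩, ?_⟩
  · simp only [List.length_append, List.length_reverse, hsk, List.length_singleton]; omega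
  · intro a ha t ht
    rw [← List.append_assoc, ← List.append_assoc, List.getLast?_append] at ha
    simp at ha ht
    subst ha ht
    exact (hN₂ _ hz).symm
  · simp only [List.length_append, List.length_reverse, hsk, List.length_singleton]; omega

/-- A graph in which any two disjoint sets of at least `u` vertices are joined and whose minimum
degree is at least `20 * u` contains cycles of all lengths. -/
theorem IsJoined.exists_cycle [DecidableEq V] [Fintype V] {u : ℕ} (hu : 1 ≤ u)
    (hG : IsJoined G u) (hdeg : ∀ v, ∃ N : Finset V, (∀ y ∈ N, G.Adj v y) ∧ 20 * u ≤ N.card)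
    {k : ℕ} (hk : 3 ≤ k) (hkV : k ≤ Fintype.card V) : ∃ l, IsCycleList G l ∧ l.length = k := by
  induction k with
  | zero => omega
  | succ k ih =>
    obtain ⟨v⟩ : Nonempty V := Fintype.card_pos_iff.1 (by omega)
    obtain ⟨N, hN, hNc⟩ := hdeg v
    by_cases h1 : k ≤ 18 * u
    · exact hG.exists_short_cycle hN (by omega) (by omega)
    by_cases h2 : k + 15 * u ≤ Fintype.card V
    · obtain ⟨N₁, hN₁, hc₁⟩ := Finset.exists_subset_card_eq (show 8 * u ≤ N.card by omega)
      obtain ⟨N₂, hN₂, hc₂⟩ := Finset.exists_subset_card_eq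
        (show u ≤ (N \ N₁).card by rw [Finset.card_sdiff_of_subset hN₁]; omega)
      have hd : Disjoint N₁ N₂ := Finset.disjoint_of_subset_right hN₂ Finset.disjoint_sdiff
      refine hG.exists_medium_cycle hu (N₁ := N₁) (N₂ := N₂) (W := (insert v (N₁ ∪ N₂))ᶜ)
        (fun y hy => hN y (hN₁ hy)) (fun y hy => hN y (Finset.sdiff_subset (hN₂ hy))) hd ?_ ?_
        (by simp) (by omega) (by omega) (by omega) ?_
      · rw [Finset.disjoint_left]; intro a ha; simp [ha]
      · rw [Finset.disjoint_left]; intro a ha; simp [ha]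
      · have h3 := Finset.card_insert_le v (N₁ ∪ N₂)
        have h4 := Finset.card_union_le N₁ N₂
        rw [Finset.card_compl]
        omega
    · obtain ⟨l, hl, hlk⟩ := ih (by omega) (by omega)
      have hcard : l.toFinset.card = k := by rw [List.toFinset_card_of_nodup hl.1.1, hlk]
      have hcompl : l.toFinsetᶜ.card = Fintype.card V - k := by rw [Finset.card_compl, hcard]
      obtain ⟨x, hx⟩ : l.toFinsetᶜ.Nonempty := by rw [← Finset.card_pos]; omega
      rw [Finset.mem_compl, List.mem_toFinset] at hx
      obtain ⟨N, hN, hNc⟩ := hdeg x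
      have h3 : N.card ≤ (N ∩ l.toFinset).card + l.toFinsetᶜ.card := by
        rw [← Finset.card_inter_add_card_sdiff N l.toFinset]
        gcongr
        intro a ha
        simp only [Finset.mem_sdiff] at ha
        simpa using ha.2
      obtain ⟨l', hl', hlk'⟩ := hl.exists_insert hG hx (N := N ∩ l.toFinset)
        (fun y hy => List.mem_toFinset.1 (Finset.inter_subset_right hy))
        (fun y hy => hN y (Finset.inter_subset_left hy)) (by omega)
      exact ⟨l', hl', by omega⟩

theorem IsJoined.isPancyclic {n u : ℕ} {G : SimpleGraph (Fin n)} (hu : 1 ≤ u) (hG : IsJoined G u)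
    (hdeg : ∀ v, ∃ N : Finset (Fin n), (∀ y ∈ N, G.Adj v y) ∧ 20 * u ≤ N.card) :
    IsPancyclic G := by
  intro k hk hkn
  obtain ⟨l, hl, rfl⟩ := hG.exists_cycle hu hdeg hk (by simpa using hkn)
  exact hl.exists_walk

end Pancyclic

/-! ### Maker's strategy: keeping her share of many sets at once -/

section Maker

variable {α : Type} [DecidableEq α]

/-- The danger of the set `A` when Maker holds `M` and Breaker holds `B`: it is multiplied by
`1 - a` whenever Maker claims an element of `A`, and by `1 + a` for every `b` elements of `A`
claimed by Breaker. -/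
noncomputable def danger (a : ℝ) (b : ℕ) (M B A : Finset α) : ℝ :=
  (1 - a) ^ (A ∩ M).card * (1 + a) ^ (((A ∩ B).card : ℝ) / b)

/-- The total danger of the sets of the family `𝒜` which contain `x`. -/
noncomputable def elementDanger (a : ℝ) (b : ℕ) (𝒜 : Finset (Finset α)) (M B : Finset α) (x : α) :
    ℝ :=
  ∑ A ∈ 𝒜, if x ∈ A then danger a b M B A else 0

variable {a : ℝ} {b : ℕ}

theorem danger_pos (ha₀ : 0 < a) (ha₁ : a < 1) (M B A : Finset α) : 0 < danger a b M B A :=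
  mul_pos (pow_pos (by linarith) _) (Real.rpow_pos_of_pos (by linarith) _)

/-- By Bernoulli's inequality, a round changes the danger of a set at most by the sum of the
first-order changes. -/
theorem danger_round_le (ha₀ : 0 < a) (ha₁ : a < 1) (hb : 1 ≤ b) {M B S : Finset α} {x : α}
    (hx : x ∉ M) (hS : Disjoint B S) (hSb : S.card ≤ b) (A : Finset α) :
    danger a b (insert x M) (B ∪ S) A ≤ danger a b M B A +
      a / b * ((A ∩ S).card * danger a b M B A) - a * (if x ∈ A then danger a b M B A else 0) := by
  have hb' : (0 : ℝ) < b := by exact_mod_cast hb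
  have hcard : (A ∩ (B ∪ S)).card = (A ∩ B).card + (A ∩ S).card := by
    rw [Finset.inter_union_distrib_left, Finset.card_union_of_disjoint]
    exact hS.mono Finset.inter_subset_right Finset.inter_subset_right
  have hAS : ((A ∩ S).card : ℝ) ≤ b := by
    exact_mod_cast (Finset.card_le_card Finset.inter_subset_right).trans hSb
  have hbern : (1 + a) ^ (((A ∩ S).card : ℝ) / b) ≤ 1 + (A ∩ S).card / b * a :=
    rpow_one_add_le_one_add_mul_self (by linarith) (by positivity)
      ((div_le_one hb').2 hAS)
  have hB : (1 + a) ^ (((A ∩ (B ∪ S)).card : ℝ) / b) =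
      (1 + a) ^ (((A ∩ B).card : ℝ) / b) * (1 + a) ^ (((A ∩ S).card : ℝ) / b) := by
    rw [hcard, Nat.cast_add, add_div, Real.rpow_add (by linarith)]
  have hd := danger_pos (b := b) ha₀ ha₁ M B A
  have ht : 0 ≤ ((A ∩ S).card : ℝ) / b * a := by positivity
  by_cases hxA : x ∈ A
  · have hM : (A ∩ insert x M).card = (A ∩ M).card + 1 := by
      rw [Finset.inter_insert_of_mem hxA, Finset.card_insert_of_notMem (by simp [hx])]
    have : danger a b (insert x M) (B ∪ S) A =
        danger a b M B A * ((1 - a) * (1 + a) ^ (((A ∩ S).card : ℝ) / b)) := by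
      rw [danger, danger, hM, hB, pow_succ]; ring
    rw [this, if_pos hxA]
    calc _ ≤ danger a b M B A * ((1 - a) * (1 + (A ∩ S).card / b * a)) := by
          gcongr
      _ ≤ danger a b M B A * (1 + (A ∩ S).card / b * a - a) := by
          gcongr; nlinarith
      _ = _ := by ring
  · have : danger a b (insert x M) (B ∪ S) A =
        danger a b M B A * (1 + a) ^ (((A ∩ S).card : ℝ) / b) := by
      rw [danger, danger, hB, Finset.inter_insert_of_notMem hxA]; ring
    rw [this, if_neg hxA]
    calc _ ≤ danger a b M B A * (1 + (A ∩ S).card / b * a) := by gcongr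
      _ = _ := by ring

/-- The total danger does not increase in a round in which Maker claims an element of maximal
danger. -/
theorem sum_danger_round_le (ha₀ : 0 < a) (ha₁ : a < 1) (hb : 1 ≤ b) (𝒜 : Finset (Finset α))
    {M B S : Finset α} {x : α} (hx : x ∉ M) (hS : Disjoint B S) (hSb : S.card ≤ b)
    (hmax : ∀ y ∈ S, elementDanger a b 𝒜 M B y ≤ elementDanger a b 𝒜 M B x) :
    ∑ A ∈ 𝒜, danger a b (insert x M) (B ∪ S) A ≤ ∑ A ∈ 𝒜, danger a b M B A := by
  have hb' : (0 : ℝ) < b := by exact_mod_cast hb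
  have hswap : ∑ A ∈ 𝒜, ((A ∩ S).card : ℝ) * danger a b M B A =
      ∑ y ∈ S, elementDanger a b 𝒜 M B y := by
    unfold elementDanger
    rw [Finset.sum_comm]
    refine Finset.sum_congr rfl fun A _ => ?_
    rw [← Finset.sum_filter, Finset.sum_const, nsmul_eq_mul, Finset.inter_comm,
      Finset.filter_mem_eq_inter]
  have hx₀ : 0 ≤ elementDanger a b 𝒜 M B x :=
    Finset.sum_nonneg fun A _ => by split_ifs <;> simp [(danger_pos ha₀ ha₁ M B A).le]
  have hsum : ∑ y ∈ S, elementDanger a b 𝒜 M B y ≤ b * elementDanger a b 𝒜 M B x := by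
    calc _ ≤ ∑ _y ∈ S, elementDanger a b 𝒜 M B x := Finset.sum_le_sum hmax
      _ = S.card * elementDanger a b 𝒜 M B x := by rw [Finset.sum_const, nsmul_eq_mul]
      _ ≤ _ := by gcongr
  calc ∑ A ∈ 𝒜, danger a b (insert x M) (B ∪ S) A
      ≤ ∑ A ∈ 𝒜, (danger a b M B A + a / b * ((A ∩ S).card * danger a b M B A) -
          a * (if x ∈ A then danger a b M B A else 0)) :=
        Finset.sum_le_sum fun A _ => danger_round_le ha₀ ha₁ hb hx hS hSb A
    _ = ∑ A ∈ 𝒜, danger a b M B A + a / b * ∑ y ∈ S, elementDanger a b 𝒜 M B y -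
          a * elementDanger a b 𝒜 M B x := by
        rw [Finset.sum_sub_distrib, Finset.sum_add_distrib, ← Finset.mul_sum, ← Finset.mul_sum,
          hswap, elementDanger]
    _ ≤ ∑ A ∈ 𝒜, danger a b M B A + a / b * (b * elementDanger a b 𝒜 M B x) -
          a * elementDanger a b 𝒜 M B x := by gcongr
    _ = _ := by field_simp; ring

/-- If the danger of `A` is at most `N` when all its elements have been claimed, then Maker holds
almost a share of `1 / (b + 1)` of them. -/
theorem share_le_of_danger_le (ha₀ : 0 < a) (ha₁ : a < 1) (hb : 1 ≤ b) {M B A : Finset α} {N : ℝ}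
    (hN : 0 ≤ Real.log N) (h : danger a b M B A ≤ N) :
    (1 - a) ^ 2 / (b + 1) * ((A ∩ M).card + (A ∩ B).card) - Real.log N / a ≤ (A ∩ M).card := by
  have hb' : (0 : ℝ) < b := by exact_mod_cast hb
  have h1a : 0 < 1 - a := by linarith
  set k : ℝ := ((A ∩ M).card : ℝ)
  set m : ℝ := ((A ∩ B).card : ℝ)
  have hk : 0 ≤ k := Nat.cast_nonneg _
  have hm : 0 ≤ m := Nat.cast_nonneg _
  have hlog : k * Real.log (1 - a) + m / b * Real.log (1 + a) ≤ Real.log N := by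
    have := Real.log_le_log (danger_pos ha₀ ha₁ M B A) h
    rwa [danger, Real.log_mul (pow_pos h1a _).ne' (Real.rpow_pos_of_pos (by linarith) _).ne',
      Real.log_pow, Real.log_rpow (by linarith)] at this
  have h1 : a * (1 - a) ≤ Real.log (1 + a) := by
    have := Real.one_sub_inv_le_log_of_pos (show 0 < 1 + a by linarith)
    refine le_trans ?_ this
    have h : 1 - (1 + a)⁻¹ = a / (1 + a) := by field_simp; ring
    rw [h, le_div_iff₀ (by linarith)]
    nlinarith [mul_pos ha₀ (mul_pos ha₀ ha₀)]
  have h2 : -(a / (1 - a)) ≤ Real.log (1 - a) := by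
    have := Real.one_sub_inv_le_log_of_pos h1a
    refine le_trans (le_of_eq ?_) this
    field_simp
    ring
  have h3 : m / b * (1 - a) - k / (1 - a) ≤ Real.log N / a := by
    rw [le_div_iff₀ ha₀]
    calc (m / b * (1 - a) - k / (1 - a)) * a = k * -(a / (1 - a)) + m / b * (a * (1 - a)) := by
          field_simp; ring
      _ ≤ _ := by refine le_trans ?_ hlog; gcongr
  set K := Real.log N / a
  -- Multiply by `b * (1 - a) / (b + 1)`, which is at most one.
  have hK : 0 ≤ K := div_nonneg hN ha₀.le
  have h4 : m * (1 - a) ^ 2 - k * b ≤ K * (b + 1) := by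
    have h5 : (m / b * (1 - a) - k / (1 - a)) * (b * (1 - a)) ≤ K * (b * (1 - a)) := by
      gcongr
    have h6 : (m / b * (1 - a) - k / (1 - a)) * (b * (1 - a)) = m * (1 - a) ^ 2 - k * b := by
      field_simp
    have h7 : b * (1 - a) ≤ (b + 1 : ℝ) := by nlinarith
    rw [h6] at h5
    exact h5.trans (by gcongr)
  have h8 : (1 - a) ^ 2 * k ≤ k := by
    have : (1 - a) ^ 2 ≤ 1 := by nlinarith
    nlinarith
  rw [div_mul_eq_mul_div, sub_le_iff_le_add, div_le_iff₀ (by linarith)]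
  nlinarith

/-- Maker claims an element of maximal danger. -/
theorem exists_dangerStrategy [Nonempty α] (a : ℝ) (b : ℕ) (𝒜 : Finset (Finset α)) :
    ∃ σ : MakerStrategy α, ∀ h p, p.free.Nonempty → σ h p ∈ p.free ∧
      ∀ y ∈ p.free, elementDanger a b 𝒜 p.maker p.breaker y ≤
        elementDanger a b 𝒜 p.maker p.breaker (σ h p) := by
  have : ∀ p : Position α, ∃ x, p.free.Nonempty → x ∈ p.free ∧
      ∀ y ∈ p.free, elementDanger a b 𝒜 p.maker p.breaker y ≤
        elementDanger a b 𝒜 p.maker p.breaker x := by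
    intro p
    by_cases hp : p.free.Nonempty
    · obtain ⟨x, hx⟩ := Finset.exists_max_image _ (elementDanger a b 𝒜 p.maker p.breaker) hp
      exact ⟨x, fun _ => hx⟩
    · exact ⟨Classical.arbitrary α, fun h => absurd h hp⟩
  choose f hf using this
  exact ⟨fun _ p => f p, fun _ p => hf p⟩

/-- What Maker maintains by the danger strategy for the family `𝒜`. The additive loss of
`K = log 𝒜.card / a` per stage sums up to at most `2 * K`, since the multiplicative loss is at
least two in each stage. -/
structure DangerInvariant (H : GameHypergraph α) (a : ℝ) (b : ℕ) (𝒜 : Finset (Finset α))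
    (p : Position α) : Prop where
  board_subset : p.current.board ⊆ H.board
  winning_eq : p.current.winning = {F | F ∈ H.winning ∧ F ⊆ p.current.board}
  maker_subset : p.maker ⊆ p.current.board
  breaker_subset : p.breaker ⊆ p.current.board
  disjoint : Disjoint p.maker p.breaker
  danger_le : ∑ A ∈ 𝒜, danger a b p.maker p.breaker A ≤ 𝒜.card
  share_le : ∀ A ∈ 𝒜, ((1 - a) ^ 2 / (b + 1)) ^ p.completed * ((A ∩ H.board).card : ℝ) -
    2 * (Real.log 𝒜.card / a) ≤ (A ∩ p.current.board).card

theorem makerCanLast_of_shares [Nonempty α] (H : GameHypergraph α) (ha₀ : 0 < a) (ha₁ : a < 1)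
    (hb : 1 ≤ b) (𝒜 : Finset (Finset α)) (s : ℕ)
    (hwin : ∀ X ⊆ H.board, (∀ A ∈ 𝒜, ((1 - a) ^ 2 / (b + 1)) ^ s * ((A ∩ H.board).card : ℝ) -
      2 * (Real.log 𝒜.card / a) ≤ (A ∩ X).card) → ∃ F ∈ H.winning, F ⊆ X) :
    MakerCanLast H b s := by
  obtain ⟨σ, hσ⟩ := exists_dangerStrategy a b 𝒜
  refine ⟨σ, fun h p _ hp => (hσ h p hp).1, ?_⟩
  have hlog : 0 ≤ Real.log 𝒜.card / a := div_nonneg (Real.log_natCast_nonneg _) ha₀.le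
  have hinit : ∑ A ∈ 𝒜, danger a b (∅ : Finset α) ∅ A ≤ 𝒜.card := by simp [danger]
  have key : ∀ h p, Play H b σ h p → DangerInvariant H a b 𝒜 p := by
    intro h p hp
    induction hp with
    | start =>
      refine ⟨subset_rfl, ?_, by simp [Position.start], by simp [Position.start],
        by simp [Position.start], hinit, ?_⟩
      · ext F
        exact ⟨fun hF => ⟨hF, H.subset_board F hF⟩, fun hF => hF.1⟩
      · intro A _
        simp only [Position.start, pow_zero, one_mul]
        linarith
    | round h p S _ hx hS hSb ih =>
      have hne : p.free.Nonempty := ⟨_, hx⟩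
      have hmax := (hσ h p hne).2
      have hSf : ∀ y ∈ S, y ∈ p.free ∧ y ≠ σ h p := fun y hy => by
        have := hS hy
        rw [Finset.mem_erase] at this
        exact ⟨this.2, this.1⟩
      have hfree : ∀ y ∈ p.free, y ∈ p.current.board ∧ y ∉ p.maker ∧ y ∉ p.breaker := by
        intro y hy
        simpa [Position.free] using hy
      have hx' := hfree _ hx
      refine ⟨ih.board_subset, ih.winning_eq, ?_, ?_, ?_, ?_, ih.share_le⟩
      · exact Finset.insert_subset hx'.1 ih.maker_subset
      · exact Finset.union_subset ih.breaker_subset fun y hy => (hfree y (hSf y hy).1).1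
      · change Disjoint (insert (σ h p) p.maker) (p.breaker ∪ S)
        rw [Finset.disjoint_insert_left, Finset.disjoint_union_right, Finset.mem_union, not_or]
        refine ⟨⟨hx'.2.2, fun hS' => (hSf _ hS').2 rfl⟩, ih.disjoint, ?_⟩
        rw [Finset.disjoint_right]
        exact fun y hy => (hfree y (hSf y hy).1).2.1
      · refine (sum_danger_round_le ha₀ ha₁ hb 𝒜 hx'.2.1 ?_ hSb
          fun y hy => hmax y (hSf y hy).1).trans ih.danger_le
        rw [Finset.disjoint_right]
        exact fun y hy => (hfree y (hSf y hy).1).2.2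
    | nextStage h p _ hfree ih =>
      refine ⟨ih.maker_subset.trans ih.board_subset, ?_, by simp [Position.nextStage],
        by simp [Position.nextStage], by simp [Position.nextStage], hinit, ?_⟩
      · ext F
        simp only [Position.nextStage, GameHypergraph.restrict, ih.winning_eq, Set.mem_ofPred_eq]
        exact ⟨fun hF => ⟨hF.1.1, hF.2⟩, fun hF => ⟨⟨hF.1, hF.2.trans ih.maker_subset⟩, hF.2⟩⟩
      · intro A hA
        have hboard : p.current.board = p.maker ∪ p.breaker :=
          (Finset.sdiff_eq_empty_iff_subset.1 hfree).antisymm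
            (Finset.union_subset ih.maker_subset ih.breaker_subset)
        have hsplit : ((A ∩ p.current.board).card : ℝ) =
            (A ∩ p.maker).card + (A ∩ p.breaker).card := by
          rw [hboard, Finset.inter_union_distrib_left, Finset.card_union_of_disjoint, Nat.cast_add]
          exact ih.disjoint.mono Finset.inter_subset_right Finset.inter_subset_right
        have h1 := share_le_of_danger_le ha₀ ha₁ hb (M := p.maker) (B := p.breaker) (A := A)
          (Real.log_natCast_nonneg 𝒜.card)
          ((Finset.single_le_sum (fun A _ => (danger_pos ha₀ ha₁ p.maker p.breaker A).le)
            hA).trans ih.danger_le)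
        rw [← hsplit] at h1
        have h2 := ih.share_le A hA
        have hq₀ : 0 ≤ (1 - a) ^ 2 / ((b : ℝ) + 1) := by positivity
        have hq : (1 - a) ^ 2 / ((b : ℝ) + 1) ≤ 1 / 2 := by
          have hb' : (1 : ℝ) ≤ b := by exact_mod_cast hb
          rw [div_le_div_iff₀ (by linarith) (by norm_num)]
          nlinarith
        change ((1 - a) ^ 2 / ((b : ℝ) + 1)) ^ (p.completed + 1) * ((A ∩ H.board).card : ℝ) -
          2 * (Real.log 𝒜.card / a) ≤ (A ∩ p.maker).card
        rw [pow_succ]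
        nlinarith [mul_le_mul_of_nonneg_left h2 hq₀]
  intro h p hp hs
  have hinv := key h p hp
  obtain ⟨F, hF, hFX⟩ := hwin p.current.board hinv.board_subset
    (fun A hA => hs ▸ hinv.share_le A hA)
  exact ⟨F, by rw [hinv.winning_eq]; exact ⟨hF, hFX⟩⟩

end Maker

/-! ### Breaker's strategies: a multistage Erdős–Selfridge argument and halving classes -/

section Breaker

variable {α : Type} [DecidableEq α]

/-- Against the strategy `σ` of Maker, Breaker can achieve that stage `s + 1` is played on the
board `X`. -/
def Reaches (H : GameHypergraph α) (b : ℕ) (σ : MakerStrategy α) (s : ℕ) (X : Finset α) : Prop :=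
  ∃ h p, Play H b σ h p ∧ p.completed = s ∧ p.maker = ∅ ∧ p.breaker = ∅ ∧ p.current.board = X ∧
    p.current.winning = {F | F ∈ H.winning ∧ F ⊆ X}

variable {H : GameHypergraph α} {b : ℕ} {σ : MakerStrategy α}

theorem reaches_zero : Reaches H b σ 0 H.board := by
  refine ⟨[], _, Play.start, rfl, rfl, rfl, rfl, ?_⟩
  ext F
  exact ⟨fun hF => ⟨hF, H.subset_board F hF⟩, fun hF => hF.1⟩

/-- Breaker can enforce at the end of a stage every invariant which he can restore in each round. -/
theorem Reaches.exists_stage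
    (hσ : ∀ h p, Play H b σ h p → p.free.Nonempty → σ h p ∈ p.free) {s : ℕ} {X : Finset α}
    (hX : Reaches H b σ s X) (I : Finset α → Finset α → Prop) (h₀ : I ∅ ∅)
    (hI : ∀ M B x, M ⊆ X → B ⊆ X → Disjoint M B → x ∈ X \ (M ∪ B) → I M B →
      ∃ S ⊆ (X \ (M ∪ B)).erase x, S.card ≤ b ∧ I (insert x M) (B ∪ S)) :
    ∃ M B, M ∪ B = X ∧ Disjoint M B ∧ I M B ∧ Reaches H b σ (s + 1) M := by
  have key : ∀ (k : ℕ) h p, Play H b σ h p → p.completed = s → p.current.board = X →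
      p.current.winning = {F | F ∈ H.winning ∧ F ⊆ X} → p.maker ⊆ X → p.breaker ⊆ X →
      Disjoint p.maker p.breaker → I p.maker p.breaker → p.free.card ≤ k →
      ∃ M B, M ∪ B = X ∧ Disjoint M B ∧ I M B ∧ Reaches H b σ (s + 1) M := by
    intro k
    induction k with
    | zero =>
      intro h p hp hs hb hw hM hB hd hIp hk
      have hfree : p.free = ∅ := Finset.card_eq_zero.1 (by omega)
      refine ⟨p.maker, p.breaker, ?_, hd, hIp, _, _, Play.nextStage h p hp hfree,
        by simp [Position.nextStage, hs], rfl, rfl, rfl, ?_⟩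
      · refine (Finset.union_subset hM hB).antisymm ?_
        rw [← hb]
        exact Finset.sdiff_eq_empty_iff_subset.1 hfree
      · ext F
        simp only [Position.nextStage, GameHypergraph.restrict, hw, Set.mem_ofPred_eq]
        exact ⟨fun hF => ⟨hF.1.1, hF.2⟩, fun hF => ⟨⟨hF.1, hF.2.trans hM⟩, hF.2⟩⟩
    | succ k ih =>
      intro h p hp hs hb hw hM hB hd hIp hk
      by_cases hk' : p.free.card ≤ k
      · exact ih h p hp hs hb hw hM hB hd hIp hk'
      have hx := hσ h p hp (Finset.card_pos.1 (by omega))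
      have hfree : p.free = X \ (p.maker ∪ p.breaker) := by rw [Position.free, hb]
      obtain ⟨S, hS, hSb, hIS⟩ := hI p.maker p.breaker (σ h p) hM hB hd (hfree ▸ hx) hIp
      have hx' := hx
      simp only [hfree, Finset.mem_sdiff, Finset.mem_union, not_or] at hx'
      have hS' : ∀ y ∈ S, y ≠ σ h p ∧ y ∈ X ∧ y ∉ p.maker ∧ y ∉ p.breaker := by
        intro y hy
        simpa only [Finset.mem_erase, Finset.mem_sdiff, Finset.mem_union, not_or] using hS hy
      refine ih _ _ (Play.round h p S hp hx (hfree ▸ hS) hSb) hs hb hw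
        (Finset.insert_subset hx'.1 hM) (Finset.union_subset hB fun y hy => (hS' y hy).2.1)
        ?_ hIS ?_
      · change Disjoint (insert (σ h p) p.maker) (p.breaker ∪ S)
        rw [Finset.disjoint_insert_left, Finset.disjoint_union_right, Finset.mem_union, not_or]
        refine ⟨⟨hx'.2.2, fun h => (hS' _ h).1 rfl⟩, hd, ?_⟩
        rw [Finset.disjoint_right]
        exact fun y hy => (hS' y hy).2.2.1
      · have hlt : (p.round (σ h p) S).free ⊂ p.free := by
          rw [Finset.ssubset_iff_of_subset]
          · exact ⟨σ h p, hx, by simp [Position.free, Position.round]⟩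
          · intro y hy
            simp only [Position.free, Position.round, Finset.mem_sdiff, Finset.mem_union,
              Finset.mem_insert, not_or] at hy ⊢
            exact ⟨hy.1, hy.2.1.2, hy.2.2.1⟩
        have := Finset.card_lt_card hlt
        omega
  obtain ⟨h, p, hp, hs, hM, hB, hb, hw⟩ := hX
  exact key _ h p hp hs hb hw (by simp [hM]) (by simp [hB]) (by simp [hM]) (by rwa [hM, hB]) le_rfl

/-- The Erdős–Selfridge weight of `A` with factor `g A`, when Maker holds `M` and Breaker holds
`B`. -/
noncomputable def liveWeight (b : ℕ) (g : Finset α → ℝ) (M B A : Finset α) : ℝ :=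
  if Disjoint A B then g A * ((b + 1 : ℝ)⁻¹) ^ (A \ M).card else 0

/-- The Erdős–Selfridge potential of the family `𝒜`. -/
noncomputable def potential (b : ℕ) (g : Finset α → ℝ) (𝒜 : Finset (Finset α))
    (M B : Finset α) : ℝ :=
  ∑ A ∈ 𝒜, liveWeight b g M B A

/-- The contribution to the potential of the sets which contain `x`. -/
noncomputable def elementPotential (b : ℕ) (g : Finset α → ℝ) (𝒜 : Finset (Finset α))
    (M B : Finset α) (x : α) : ℝ :=
  ∑ A ∈ 𝒜, if x ∈ A then liveWeight b g M B A else 0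

variable {g : Finset α → ℝ} {𝒜 : Finset (Finset α)} {M B : Finset α}

theorem liveWeight_nonneg (hg : ∀ A, 0 ≤ g A) (A : Finset α) : 0 ≤ liveWeight b g M B A := by
  unfold liveWeight
  split_ifs
  · exact mul_nonneg (hg A) (by positivity)
  · exact le_rfl

theorem elementPotential_le_potential (hg : ∀ A, 0 ≤ g A) (x : α) :
    elementPotential b g 𝒜 M B x ≤ potential b g 𝒜 M B := by
  refine Finset.sum_le_sum fun A _ => ?_
  split_ifs
  · exact le_rfl
  · exact liveWeight_nonneg hg A

theorem potential_insert_maker {x : α} (hx : x ∉ M) :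
    potential b g 𝒜 (insert x M) B =
      potential b g 𝒜 M B + b * elementPotential b g 𝒜 M B x := by
  unfold potential elementPotential
  rw [Finset.mul_sum, ← Finset.sum_add_distrib]
  refine Finset.sum_congr rfl fun A _ => ?_
  by_cases hxA : x ∈ A
  · rw [if_pos hxA]
    unfold liveWeight
    split_ifs
    · have h1 : (A \ M).card = (A \ insert x M).card + 1 := by
        rw [Finset.sdiff_insert, Finset.card_erase_add_one (by simp [hxA, hx])]
      have hb : (b : ℝ) + 1 ≠ 0 := by positivity
      rw [h1, pow_succ]
      field_simp
      ring
    · simp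
  · rw [if_neg hxA, liveWeight, liveWeight, Finset.sdiff_insert_of_notMem hxA]
    simp

theorem potential_insert_breaker (y : α) :
    potential b g 𝒜 M (insert y B) =
      potential b g 𝒜 M B - elementPotential b g 𝒜 M B y := by
  unfold potential elementPotential
  rw [← Finset.sum_sub_distrib]
  refine Finset.sum_congr rfl fun A _ => ?_
  unfold liveWeight
  by_cases hy : y ∈ A <;> simp [hy, Finset.disjoint_insert_right]

theorem elementPotential_anti (hg : ∀ A, 0 ≤ g A) {B' : Finset α} (hB : B ⊆ B') (x : α) :
    elementPotential b g 𝒜 M B' x ≤ elementPotential b g 𝒜 M B x := by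
  refine Finset.sum_le_sum fun A _ => ?_
  split_ifs with hx
  · by_cases hd : Disjoint A B'
    · rw [liveWeight, liveWeight, if_pos hd, if_pos (hd.mono_right hB)]
    · rw [liveWeight, if_neg hd]
      exact liveWeight_nonneg hg A
  · exact le_rfl

/-- Breaker claims `k` elements greedily. As their contributions decrease, each of them compensates
for at least the contribution of any element that is left. -/
theorem exists_greedy (hg : ∀ A, 0 ≤ g A) (k : ℕ) (B R : Finset α) :
    ∃ S ⊆ R, S.card ≤ k ∧ potential b g 𝒜 M (B ∪ S) ≤ potential b g 𝒜 M B ∧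
      ∀ z ∈ R \ S, potential b g 𝒜 M (B ∪ S) + k * elementPotential b g 𝒜 M (B ∪ S) z ≤
        potential b g 𝒜 M B := by
  induction k generalizing B R with
  | zero => exact ⟨∅, by simp, by simp, by simp, by simp⟩
  | succ k ih =>
    rcases R.eq_empty_or_nonempty with rfl | hR
    · exact ⟨∅, by simp, by simp, by simp, by simp⟩
    obtain ⟨y, hy, hmax⟩ := Finset.exists_max_image R (elementPotential b g 𝒜 M B) hR
    obtain ⟨S, hS, hSk, hle, hz⟩ := ih (insert y B) (R.erase y)
    have hBS : B ∪ insert y S = insert y B ∪ S := by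
      rw [Finset.union_insert, Finset.insert_union]
    have hy₀ : 0 ≤ elementPotential b g 𝒜 M B y := Finset.sum_nonneg fun A _ => by
      split_ifs <;> simp [liveWeight_nonneg hg]
    rw [potential_insert_breaker] at hle hz
    refine ⟨insert y S, Finset.insert_subset hy (hS.trans (Finset.erase_subset _ _)),
      (Finset.card_insert_le _ _).trans (by omega), ?_, ?_⟩
    · rw [hBS]; linarith
    · intro z hzR
      simp only [Finset.mem_sdiff, Finset.mem_insert, not_or] at hzR
      have h1 := hz z (by simp [hzR])
      have h2 := elementPotential_anti (b := b) (𝒜 := 𝒜) (M := M) hg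
        (show B ⊆ insert y B ∪ S from (Finset.subset_insert _ _).trans Finset.subset_union_left) z
      have h3 := hmax z hzR.1
      rw [hBS]
      push_cast
      linarith

/-- In one stage Breaker can lower the total weight of the surviving sets by a factor
`(b + 1) ^ A.card` for each set `A`, up to a factor `b + 1` that is lost because Maker moves
first. -/
theorem Reaches.exists_stage_weight
    (hσ : ∀ h p, Play H b σ h p → p.free.Nonempty → σ h p ∈ p.free) {s : ℕ} {X : Finset α}
    (hX : Reaches H b σ s X) (hg : ∀ A, 0 ≤ g A) (𝒜 : Finset (Finset α)) :
    ∃ M ⊆ X, Reaches H b σ (s + 1) M ∧ ∑ A ∈ 𝒜 with A ⊆ M, g A ≤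
      (b + 1) * ∑ A ∈ 𝒜 with A ⊆ X, g A * ((b + 1 : ℝ)⁻¹) ^ A.card := by
  set 𝒜' := {A ∈ 𝒜 | A ⊆ X} with h𝒜'
  have hΦ : potential b g 𝒜' ∅ ∅ = ∑ A ∈ 𝒜', g A * ((b + 1 : ℝ)⁻¹) ^ A.card := by
    simp [potential, liveWeight]
  rw [← hΦ]
  set C := (b + 1 : ℝ) * potential b g 𝒜' ∅ ∅ with hC
  have hΦ₀ : 0 ≤ potential b g 𝒜' ∅ ∅ := Finset.sum_nonneg fun A _ => liveWeight_nonneg hg A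
  have hb₀ : (0 : ℝ) ≤ b := Nat.cast_nonneg b
  obtain ⟨M, B, hMB, hd, ⟨hle, -⟩, hM⟩ := hX.exists_stage hσ
    (fun M B => potential b g 𝒜' M B ≤ C ∧ ∀ z ∈ X \ (M ∪ B),
      potential b g 𝒜' M B + b * elementPotential b g 𝒜' M B z ≤ C)
    (by
      refine ⟨by rw [hC]; nlinarith, fun z _ => ?_⟩
      have := mul_le_mul_of_nonneg_left
        (elementPotential_le_potential (b := b) (𝒜 := 𝒜') (M := ∅) (B := ∅) hg z) hb₀
      rw [hC]; linarith)
    (by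
      intro M B x hM hB hd hx ⟨hle, hz⟩
      obtain ⟨S, hS, hSb, hS₁, hS₂⟩ := exists_greedy (b := b) (𝒜 := 𝒜') (M := insert x M) hg b B
        ((X \ (M ∪ B)).erase x)
      have hx' := hx
      simp only [Finset.mem_sdiff, Finset.mem_union, not_or] at hx'
      have hle' : potential b g 𝒜' (insert x M) B ≤ C := by
        rw [potential_insert_maker hx'.2.1]; exact hz x hx
      refine ⟨S, hS, hSb, hS₁.trans hle', fun z hzX => (hS₂ z ?_).trans hle'⟩
      simp only [Finset.mem_sdiff, Finset.mem_union, Finset.mem_insert, Finset.mem_erase,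
        not_or] at hzX ⊢
      tauto)
  refine ⟨M, hMB ▸ Finset.subset_union_left, hM, le_trans ?_ hle⟩
  rw [potential, h𝒜', Finset.sum_filter, Finset.sum_filter]
  refine Finset.sum_le_sum fun A _ => ?_
  by_cases hA : A ⊆ M
  · rw [if_pos hA, if_pos (hA.trans (hMB ▸ Finset.subset_union_left)), liveWeight,
      if_pos (hd.mono_left hA), Finset.sdiff_eq_empty_iff_subset.2 hA]
    simp
  · rw [if_neg hA]
    split_ifs
    · exact liveWeight_nonneg hg A
    · exact le_rfl

/-- The multistage version of the Erdős–Selfridge criterion. -/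
theorem Reaches.exists_stages_weight
    (hσ : ∀ h p, Play H b σ h p → p.free.Nonempty → σ h p ∈ p.free) (𝒜 : Finset (Finset α))
    (t : ℕ) {s : ℕ} {X : Finset α} (hX : Reaches H b σ s X) :
    ∃ M ⊆ X, Reaches H b σ (s + t) M ∧ (({A ∈ 𝒜 | A ⊆ M}.card : ℕ) : ℝ) ≤
      (b + 1) ^ t * ∑ A ∈ 𝒜 with A ⊆ X, (((b + 1 : ℝ) ^ t)⁻¹) ^ A.card := by
  induction t generalizing s X with
  | zero => exact ⟨X, subset_rfl, hX, by simp⟩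
  | succ t ih =>
    obtain ⟨M, hM, hMr, hle⟩ := hX.exists_stage_weight hσ
      (g := fun A => (((b + 1 : ℝ) ^ t)⁻¹) ^ A.card) (fun A => by positivity) 𝒜
    obtain ⟨M', hM', hMr', hle'⟩ := ih hMr
    refine ⟨M', hM'.trans hM, by rwa [show s + (t + 1) = s + 1 + t by ring], hle'.trans ?_⟩
    calc (b + 1 : ℝ) ^ t * ∑ A ∈ 𝒜 with A ⊆ M, (((b + 1 : ℝ) ^ t)⁻¹) ^ A.card
        ≤ (b + 1 : ℝ) ^ t * ((b + 1) * ∑ A ∈ 𝒜 with A ⊆ X,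
            (((b + 1 : ℝ) ^ t)⁻¹) ^ A.card * ((b + 1 : ℝ)⁻¹) ^ A.card) := by gcongr
      _ = _ := by
        rw [← mul_assoc, ← pow_succ]
        congr 1
        refine Finset.sum_congr rfl fun A _ => ?_
        rw [← mul_pow, ← mul_inv, ← pow_succ]

/-- Breaker answers in the class in which Maker has played, and so halves all classes. -/
theorem Reaches.exists_stage_halve {β : Type} [DecidableEq β] (hb : 1 ≤ b)
    (hσ : ∀ h p, Play H b σ h p → p.free.Nonempty → σ h p ∈ p.free) {s : ℕ} {X : Finset α}
    (hX : Reaches H b σ s X) (f : α → β) {m : ℕ} (hm : ∀ c, {e ∈ X | f e = c}.card ≤ m) :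
    ∃ M ⊆ X, Reaches H b σ (s + 1) M ∧ ∀ c, {e ∈ M | f e = c}.card ≤ (m + 1) / 2 := by
  obtain ⟨M, B, hMB, hd, hI, hM⟩ := hX.exists_stage hσ
    (fun M B => ∀ c, {e ∈ M | f e = c}.card ≤ {e ∈ B | f e = c}.card ∨
      ({e ∈ M | f e = c}.card ≤ {e ∈ B | f e = c}.card + 1 ∧ ∀ e ∈ X \ (M ∪ B), f e ≠ c))
    (by simp)
    (by
      intro M B x hM hB hd hx hI
      have hx' := hx
      simp only [Finset.mem_sdiff, Finset.mem_union, not_or] at hx'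
      have hxI : {e ∈ M | f e = f x}.card ≤ {e ∈ B | f e = f x}.card := by
        rcases hI (f x) with h | h
        · exact h
        · exact absurd rfl (h.2 x hx)
      have hins : ∀ c, {e ∈ insert x M | f e = c}.card ≤ {e ∈ M | f e = c}.card + 1 := by
        intro c
        rw [Finset.filter_insert]
        split_ifs
        · exact Finset.card_insert_le _ _
        · omega
      have hother : ∀ c, f x ≠ c → {e ∈ insert x M | f e = c} = {e ∈ M | f e = c} := by
        intro c hc
        rw [Finset.filter_insert, if_neg hc]
      by_cases hy : ∃ y ∈ (X \ (M ∪ B)).erase x, f y = f x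
      · obtain ⟨y, hy, hyx⟩ := hy
        have hy' := hy
        simp only [Finset.mem_erase, Finset.mem_sdiff, Finset.mem_union, not_or] at hy'
        refine ⟨{y}, by simpa using hy', by simpa using hb, fun c => ?_⟩
        by_cases hc : f x = c
        · left
          have h1 := hins c
          have h2 : {e ∈ B ∪ {y} | f e = c}.card = {e ∈ B | f e = c}.card + 1 := by
            rw [Finset.union_comm, ← Finset.insert_eq, Finset.filter_insert, if_pos (hyx.trans hc),
              Finset.card_insert_of_notMem (by simp [hy'])]
          rw [hc] at hxI
          omega
        · have h2 : {e ∈ B ∪ {y} | f e = c} = {e ∈ B | f e = c} := by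
            rw [Finset.union_comm, ← Finset.insert_eq, Finset.filter_insert,
              if_neg (fun h => hc (hyx.symm.trans h))]
          rw [hother c hc, h2]
          refine (hI c).imp_right fun h => ⟨h.1, fun e he => h.2 e ?_⟩
          simp only [Finset.mem_sdiff, Finset.mem_union, Finset.mem_insert, not_or] at he ⊢
          tauto
      · push Not at hy
        refine ⟨∅, by simp, by simp, fun c => ?_⟩
        rw [Finset.union_empty]
        by_cases hc : f x = c
        · right
          have h1 := hins c
          subst hc
          refine ⟨by omega, fun e he => hy e ?_⟩
          simp only [Finset.mem_sdiff, Finset.mem_union, Finset.mem_insert, Finset.mem_erase,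
            not_or] at he ⊢
          tauto
        · rw [hother c hc]
          refine (hI c).imp_right fun h => ⟨h.1, fun e he => h.2 e ?_⟩
          simp only [Finset.mem_sdiff, Finset.mem_union, Finset.mem_insert, not_or] at he ⊢
          tauto)
  refine ⟨M, hMB ▸ Finset.subset_union_left, hM, fun c => ?_⟩
  have h1 : {e ∈ M | f e = c}.card + {e ∈ B | f e = c}.card ≤ m := by
    rw [← Finset.card_union_of_disjoint (hd.mono (Finset.filter_subset _ _)
      (Finset.filter_subset _ _)), ← Finset.filter_union, hMB]
    exact hm c
  rcases hI c with h | h <;> omega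

/-- Classes of at most `t + 1` elements are reduced to at most one element within `t` stages. -/
theorem Reaches.exists_stages_halve {β : Type} [DecidableEq β] (hb : 1 ≤ b)
    (hσ : ∀ h p, Play H b σ h p → p.free.Nonempty → σ h p ∈ p.free) (f : α → β)
    (t : ℕ) {s : ℕ} {X : Finset α} (hX : Reaches H b σ s X)
    (hm : ∀ c, {e ∈ X | f e = c}.card ≤ t + 1) :
    ∃ M ⊆ X, Reaches H b σ (s + t) M ∧ ∀ c, {e ∈ M | f e = c}.card ≤ 1 := by
  induction t generalizing s X with
  | zero => exact ⟨X, subset_rfl, hX, hm⟩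
  | succ t ih =>
    obtain ⟨M, hM, hMr, hle⟩ := hX.exists_stage_halve hb hσ f hm
    obtain ⟨M', hM', hMr', hle'⟩ := ih hMr fun c => (hle c).trans (by omega)
    exact ⟨M', hM'.trans hM, by rwa [show s + (t + 1) = s + 1 + t by ring], hle'⟩

end Breaker

/-! ### Clusters of triangles -/

section Clusters

/-- The edges `e` and `f` belong to a common triangle `x`, `y`, `z` in the edge set `X`. -/
def TriangleStep {V : Type} (X : Finset (Sym2 V)) (e f : Sym2 V) : Prop :=
  ∃ x y z : V, x ≠ y ∧ x ≠ z ∧ e = s(x, y) ∧ f = s(x, z) ∧ e ∈ X ∧ f ∈ X ∧ s(y, z) ∈ X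

theorem TriangleStep.symm {V : Type} {X : Finset (Sym2 V)} {e f : Sym2 V}
    (h : TriangleStep X e f) : TriangleStep X f e := by
  obtain ⟨x, y, z, hxy, hxz, rfl, rfl, he, hf, hyz⟩ := h
  exact ⟨x, z, y, hxz, hxy, rfl, rfl, hf, he, Sym2.eq_swap ▸ hyz⟩

/-- A nonempty proper subset of a class of edges that are connected through triangles has an edge
which is in a common triangle with an edge of the class outside. -/
theorem exists_triangleStep {V : Type} [DecidableEq V] {X A K : Finset (Sym2 V)} {e : Sym2 V}
    (hK : ∀ f, f ∈ K ↔ f ∈ X ∧ Quot.mk (TriangleStep X) f = Quot.mk _ e) (heA : e ∈ A)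
    (hAK : A ⊆ K) (hne : ¬ K ⊆ A) : ∃ f ∈ A, ∃ g ∈ K, g ∉ A ∧ TriangleStep X f g := by
  by_contra! hcon
  have hstep : ∀ f g, TriangleStep X f g → f ∈ A → g ∈ A := by
    intro f g hfg hf
    by_contra hg
    refine hcon f hf g ((hK g).2 ⟨?_, ?_⟩) hg hfg
    · obtain ⟨x, y, z, -, -, -, -, -, hgX, -⟩ := hfg
      exact hgX
    · rw [← ((hK f).1 (hAK hf)).2]
      exact (Quot.sound hfg).symm
  have hgen : ∀ f g, Relation.EqvGen (TriangleStep X) f g → (f ∈ A ↔ g ∈ A) := by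
    intro f g hfg
    induction hfg with
    | rel f g h => exact ⟨hstep f g h, hstep g f h.symm⟩
    | refl f => exact Iff.rfl
    | symm f g _ ih => exact ih.symm
    | trans f g h _ _ ih₁ ih₂ => exact ih₁.trans ih₂
  exact hne fun g hg => (hgen g e (Quot.eqvGen_exact ((hK g).1 hg).2)).2 heA

/-- Collecting one triangle after the other, a class of edges connected through triangles contains
dense sets of any size, up to one: each triangle adds a new edge inside the old vertex set, or two
new edges and at most one new vertex. -/
theorem exists_dense_subset {V : Type} [DecidableEq V] {X K : Finset (Sym2 V)} {e : Sym2 V}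
    (hK : ∀ f, f ∈ K ↔ f ∈ X ∧ Quot.mk (TriangleStep X) f = Quot.mk _ e) (he : e ∈ X) (k : ℕ)
    (hk : k + 1 ≤ K.card) : ∃ (A : Finset (Sym2 V)) (U : Finset V), e ∈ A ∧ A ⊆ K ∧ A ⊆ U.sym2 ∧
      2 * U.card ≤ A.card + 3 ∧ k + 1 ≤ A.card ∧ A.card ≤ k + 2 := by
  induction k with
  | zero =>
    induction e with | _ x y =>
    refine ⟨{s(x, y)}, {x, y}, by simp, ?_, ?_, ?_, by simp, by simp⟩
    · simpa using (hK _).2 ⟨he, rfl⟩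
    · simp
    · have := Finset.card_le_two (a := x) (b := y)
      simp only [Finset.card_singleton]
      omega
  | succ k ih =>
    obtain ⟨A, U, heA, hAK, hAU, hU, hkA, hAk⟩ := ih (by omega)
    by_cases hA : A.card = k + 2
    · exact ⟨A, U, heA, hAK, hAU, hU, by omega, by omega⟩
    have hne : ¬ K ⊆ A := fun h => by
      have := Finset.card_le_card h
      omega
    obtain ⟨f, hf, g, hgK, hgA, x, y, z, hxy, hxz, rfl, rfl, hfX, hgX, hX⟩ :=
      exists_triangleStep hK heA hAK hne
    have hxyU := Finset.mk_mem_sym2_iff.1 (hAU hf)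
    by_cases hyz : s(y, z) ∈ A
    · have hyzU := Finset.mk_mem_sym2_iff.1 (hAU hyz)
      have hcard := Finset.card_insert_of_notMem hgA
      refine ⟨insert s(x, z) A, U, Finset.mem_insert_of_mem heA, Finset.insert_subset hgK hAK,
        Finset.insert_subset ?_ hAU, by omega, by omega, by omega⟩
      exact Finset.mk_mem_sym2_iff.2 ⟨hxyU.1, hyzU.2⟩
    · have hyzK : s(y, z) ∈ K := by
        refine (hK _).2 ⟨hX, ?_⟩
        rw [← ((hK _).1 (hAK hf)).2]
        refine (Quot.sound (r := TriangleStep X) ⟨y, x, z, hxy.symm, ?_, Sym2.eq_swap, rfl, hfX, hX,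
          hgX⟩).symm
        rintro rfl
        exact hgA hf
      have hne' : s(x, z) ∉ insert s(y, z) A := by
        rw [Finset.mem_insert, not_or]
        refine ⟨fun h => ?_, hgA⟩
        rcases Sym2.eq_iff.1 h with h | h
        · exact hxy h.1
        · exact hxz h.1
      have hcard := Finset.card_insert_of_notMem hne'
      rw [Finset.card_insert_of_notMem hyz] at hcard
      have hcardU := Finset.card_insert_le z U
      have hAU' : A ⊆ (insert z U).sym2 := hAU.trans (Finset.sym2_mono (Finset.subset_insert _ _))
      refine ⟨insert s(x, z) (insert s(y, z) A), insert z U,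
        Finset.mem_insert_of_mem (Finset.mem_insert_of_mem heA),
        Finset.insert_subset hgK (Finset.insert_subset hyzK hAK),
        Finset.insert_subset ?_ (Finset.insert_subset ?_ hAU'), by omega, by omega, by omega⟩
      · exact Finset.mk_mem_sym2_iff.2 ⟨Finset.mem_insert_of_mem hxyU.1, Finset.mem_insert_self _ _⟩
      · exact Finset.mk_mem_sym2_iff.2 ⟨Finset.mem_insert_of_mem hxyU.2, Finset.mem_insert_self _ _⟩

/-- The sets of at least `2 * r` edges that are spanned by `r + 2` vertices. -/
def denseSets (n r : ℕ) : Finset (Finset (Sym2 (Fin n))) :=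
  (Finset.powersetCard (r + 2) Finset.univ).biUnion fun U =>
    {A ∈ U.sym2.powerset | 2 * r ≤ A.card}

theorem card_denseSets_le (n r : ℕ) : (denseSets n r).card ≤ n ^ (r + 2) * 2 ^ (r + 3) ^ 2 := by
  refine (Finset.card_biUnion_le_card_mul _ _ (2 ^ (r + 3) ^ 2) fun U hU => ?_).trans ?_
  · rw [Finset.mem_powersetCard] at hU
    refine (Finset.card_filter_le _ _).trans ?_
    rw [Finset.card_powerset, Finset.card_sym2, hU.2]
    exact Nat.pow_le_pow_right (by norm_num) (Nat.choose_le_pow _ _)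
  · rw [Finset.card_powersetCard, Finset.card_univ, Fintype.card_fin]
    gcongr
    exact Nat.choose_le_pow _ _

/-- If no dense set survives, then all classes of edges connected through triangles are small. -/
theorem card_class_lt {n r : ℕ} (hr : 1 ≤ r) (hn : r + 2 ≤ n) {X : Finset (Sym2 (Fin n))}
    [DecidableEq (Quot (TriangleStep X))]
    (hX : ∀ A ∈ denseSets n r, ¬ A ⊆ X) (c : Quot (TriangleStep X)) :
    {f ∈ X | Quot.mk (TriangleStep X) f = c}.card < 2 * r := by
  by_contra! hcard
  obtain ⟨e, he⟩ : {f ∈ X | Quot.mk (TriangleStep X) f = c}.Nonempty :=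
    Finset.card_pos.1 (by omega)
  rw [Finset.mem_filter] at he
  obtain ⟨heX, rfl⟩ := he
  obtain ⟨A, U, -, hAK, hAU, hU, h1, h2⟩ :=
    exists_dense_subset (fun f => Finset.mem_filter) heX (2 * r - 1) (by omega)
  obtain ⟨U', hUU', hU'⟩ := Finset.exists_superset_card_eq (n := r + 2) (s := U) (by omega)
    (by simpa using hn)
  refine hX A ?_ (hAK.trans (Finset.filter_subset _ _))
  rw [denseSets, Finset.mem_biUnion]
  refine ⟨U', by simp [Finset.mem_powersetCard, hU'], ?_⟩
  rw [Finset.mem_filter, Finset.mem_powerset]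
  exact ⟨hAU.trans (Finset.sym2_mono hUU'), by omega⟩

theorem exists_triangle_of_mem_winning {n : ℕ} (hn : 3 ≤ n) {F : Finset (Sym2 (Fin n))}
    (hF : F ∈ (PAN n).winning) :
    ∃ x y z, x ≠ y ∧ x ≠ z ∧ y ≠ z ∧ s(x, y) ∈ F ∧ s(x, z) ∈ F ∧ s(y, z) ∈ F := by
  obtain ⟨G, hG, hFG⟩ := hF
  obtain ⟨v, c, hc, hc3⟩ := hG 3 le_rfl hn
  obtain ⟨s, hs⟩ := SimpleGraph.is3Clique_iff_exists_cycle_length_three.2 ⟨v, c, hc, hc3⟩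
  obtain ⟨x, y, z, hxy, hxz, hyz, -⟩ := SimpleGraph.is3Clique_iff.1 hs
  have hmem : ∀ {a b}, G.Adj a b → s(a, b) ∈ F := fun h => by
    rw [← Finset.mem_coe, hFG]; exact h
  exact ⟨x, y, z, hxy.ne, hxz.ne, hyz.ne, hmem hxy, hmem hxz, hmem hyz⟩

/-- Once `(b + 1) ^ t` exceeds `n ^ (1 / 2)` by a power of `n`, Breaker destroys all dense sets
within `t` stages, and a bounded number of further stages destroys all triangles. -/
theorem not_makerCanLast {n b r s t : ℕ} (hb : 1 ≤ b) (hr : 1 ≤ r) (hn : r + 2 ≤ n)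
    (hpow : (n : ℝ) ^ (r + 2) * 2 ^ (r + 3) ^ 2 * (b + 1) ^ t < (((b : ℝ) + 1) ^ t) ^ (2 * r))
    (hs : t + 2 * r ≤ s) : ¬ MakerCanLast (PAN n) b s := by
  classical
  rintro ⟨σ, hσ, hwin⟩
  obtain ⟨X, hX, hXr, hcard⟩ := Reaches.exists_stages_weight hσ (denseSets n r) t reaches_zero
  have hD : (1 : ℝ) ≤ ((b : ℝ) + 1) ^ t :=
    one_le_pow₀ (by linarith [(Nat.cast_nonneg b : (0 : ℝ) ≤ b)])
  set D : ℝ := ((b : ℝ) + 1) ^ t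
  have hsum : ∑ A ∈ denseSets n r with A ⊆ (PAN n).board, (D⁻¹) ^ A.card ≤
      n ^ (r + 2) * 2 ^ (r + 3) ^ 2 * (D⁻¹) ^ (2 * r) := by
    calc _ ≤ ∑ A ∈ denseSets n r with A ⊆ (PAN n).board, (D⁻¹) ^ (2 * r) := by
          refine Finset.sum_le_sum fun A hA => ?_
          refine pow_le_pow_of_le_one (by positivity) (inv_le_one_of_one_le₀ hD) ?_
          have := (Finset.mem_filter.1 hA).1
          rw [denseSets, Finset.mem_biUnion] at this
          obtain ⟨U, -, hU⟩ := this
          exact (Finset.mem_filter.1 hU).2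
      _ ≤ (denseSets n r).card * (D⁻¹) ^ (2 * r) := by
          rw [Finset.sum_const, nsmul_eq_mul]
          gcongr
          exact Finset.filter_subset _ _
      _ ≤ _ := by
          gcongr
          exact_mod_cast card_denseSets_le n r
  have hdense : ∀ A ∈ denseSets n r, ¬ A ⊆ X := by
    have hlt : (({A ∈ denseSets n r | A ⊆ X}.card : ℕ) : ℝ) < 1 := by
      refine (hcard.trans (mul_le_mul_of_nonneg_left hsum (by positivity))).trans_lt ?_
      rw [inv_pow, ← mul_assoc, ← div_eq_mul_inv, div_lt_one (by positivity)]
      linarith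
    have h0 : {A ∈ denseSets n r | A ⊆ X} = ∅ := by
      rw [← Finset.card_eq_zero]
      exact Nat.lt_one_iff.1 (by exact_mod_cast hlt)
    exact Finset.filter_eq_empty_iff.1 h0
  obtain ⟨M, hM, hMr, hclass⟩ := hXr.exists_stages_halve hb hσ (Quot.mk (TriangleStep X)) (s - t)
    fun c => by have := card_class_lt hr hn hdense c; omega
  rw [show 0 + t + (s - t) = s by omega] at hMr
  obtain ⟨h, p, hp, hps, -, -, hpb, hpw⟩ := hMr
  obtain ⟨F, hF⟩ := hwin h p hp hps
  rw [hpw] at hF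
  obtain ⟨x, y, z, hxy, hxz, hyz, h1, h2, h3⟩ := exists_triangle_of_mem_winning (by omega) hF.1
  have hFM : ∀ {e}, e ∈ F → e ∈ M := fun he => hF.2 he
  have hstep : TriangleStep X s(x, y) s(x, z) :=
    ⟨x, y, z, hxy, hxz, rfl, rfl, hM (hFM h1), hM (hFM h2), hM (hFM h3)⟩
  have heq := Finset.card_le_one.1 (hclass (Quot.mk _ s(x, y))) s(x, y) (by simp [hFM h1])
    s(x, z) (by simp [hFM h2, Quot.sound hstep.symm])
  rcases Sym2.eq_iff.1 heq with h | h
  · exact hyz h.2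
  · exact hxz h.1

end Clusters

/-! ### Maker's family for pancyclicity -/

section MakerFamily

variable {n : ℕ}

/-- The edges of the complete graph at the vertex `v`. -/
def starEdges (v : Fin n) : Finset (Sym2 (Fin n)) :=
  (Finset.univ.erase v).image fun w => s(v, w)

/-- The edges of the complete graph between `U` and `W`. -/
def edgesBetween (U W : Finset (Fin n)) : Finset (Sym2 (Fin n)) :=
  (U ×ˢ W).image fun p => s(p.1, p.2)

/-- All stars, and the sets of edges between any two disjoint sets of `u` vertices. -/
def starsAndPairs (n u : ℕ) : Finset (Finset (Sym2 (Fin n))) :=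
  (Finset.univ : Finset (Fin n)).image starEdges ∪
    {p ∈ Finset.powersetCard u (Finset.univ : Finset (Fin n)) ×ˢ
      Finset.powersetCard u (Finset.univ : Finset (Fin n)) | Disjoint p.1 p.2}.image
        fun p => edgesBetween p.1 p.2

theorem card_starsAndPairs_le {u : ℕ} (hn : 2 ≤ n) (hu : 1 ≤ u) :
    (starsAndPairs n u).card ≤ n ^ (3 * u) := by
  have h1 : ((Finset.univ : Finset (Fin n)).image starEdges).card ≤ n ^ (2 * u) := by
    refine Finset.card_image_le.trans ?_
    rw [Finset.card_univ, Fintype.card_fin]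
    exact Nat.le_self_pow (by omega) n
  have h2 : (({p ∈ Finset.powersetCard u (Finset.univ : Finset (Fin n)) ×ˢ
      Finset.powersetCard u (Finset.univ : Finset (Fin n)) | Disjoint p.1 p.2}).image
        fun p => edgesBetween p.1 p.2).card ≤ n ^ (2 * u) := by
    refine Finset.card_image_le.trans ((Finset.card_filter_le _ _).trans ?_)
    rw [Finset.card_product, Finset.card_powersetCard, Finset.card_univ, Fintype.card_fin, two_mul,
      pow_add]
    exact Nat.mul_le_mul (Nat.choose_le_pow _ _) (Nat.choose_le_pow _ _)
  calc _ ≤ n ^ (2 * u) + n ^ (2 * u) := (Finset.card_union_le _ _).trans (add_le_add h1 h2)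
    _ = 2 * n ^ (2 * u) := by ring
    _ ≤ n * n ^ (2 * u) := by gcongr
    _ = n ^ (2 * u + 1) := by ring
    _ ≤ n ^ (3 * u) := Nat.pow_le_pow_right (by omega) (by omega)

theorem mk_mem_board {x y : Fin n} : s(x, y) ∈ (PAN n).board ↔ x ≠ y := by
  simp [PAN]

theorem starEdges_inter_board (v : Fin n) : (starEdges v ∩ (PAN n).board).card = n - 1 := by
  rw [Finset.inter_eq_left.2, starEdges, Finset.card_image_of_injective]
  · simp
  · intro x y h
    exact Sym2.congr_right.1 h
  · intro e he
    obtain ⟨w, hw, rfl⟩ := Finset.mem_image.1 he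
    exact mk_mem_board.2 (Finset.ne_of_mem_erase hw).symm

theorem edgesBetween_inter_board {U W : Finset (Fin n)} (hd : Disjoint U W) :
    (edgesBetween U W ∩ (PAN n).board).card = U.card * W.card := by
  rw [Finset.disjoint_left] at hd
  rw [Finset.inter_eq_left.2, edgesBetween, Finset.card_image_of_injOn, Finset.card_product]
  · rintro ⟨x, y⟩ hxy ⟨x', y'⟩ hxy' h
    simp only [Finset.coe_product, Set.mem_prod, Finset.mem_coe] at hxy hxy'
    rcases Sym2.eq_iff.1 h with h | h
    · exact Prod.ext h.1 h.2
    · simp only at h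
      exact absurd hxy'.2 (h.1 ▸ hd hxy.1)
  · intro e he
    obtain ⟨⟨x, y⟩, hxy, rfl⟩ := Finset.mem_image.1 he
    rw [Finset.mem_product] at hxy
    refine mk_mem_board.2 fun h => hd hxy.1 ?_
    simp only at h
    rw [h]; exact hxy.2

/-- Maker can last for `s` stages if her shares of the stars and of the sets of edges between large
sets of vertices stay large enough. -/
theorem makerCanLast_pan {b u s : ℕ} {a : ℝ} (ha₀ : 0 < a) (ha₁ : a < 1) (hb : 1 ≤ b)
    (hn : 2 ≤ n) (hu : 1 ≤ u)
    (hstar : 20 * u + 2 * (3 * u * Real.log n / a) ≤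
      ((1 - a) ^ 2 / (b + 1)) ^ s * ((n : ℝ) - 1))
    (hpair : 2 * (3 * u * Real.log n / a) < ((1 - a) ^ 2 / (b + 1)) ^ s * ((u : ℝ) * u)) :
    MakerCanLast (PAN n) b s := by
  classical
  let v₀ : Fin n := ⟨0, by omega⟩
  have : Nonempty (Sym2 (Fin n)) := ⟨s(v₀, v₀)⟩
  refine makerCanLast_of_shares (PAN n) ha₀ ha₁ hb (starsAndPairs n u) s fun X hX hshare => ?_
  have hcard : 0 < (starsAndPairs n u).card := Finset.card_pos.2
    ⟨starEdges v₀, Finset.mem_union_left _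
      (Finset.mem_image_of_mem _ (Finset.mem_univ _))⟩
  have hlog : Real.log (starsAndPairs n u).card / a ≤ 3 * u * Real.log n / a := by
    gcongr
    have h1 : ((starsAndPairs n u).card : ℝ) ≤ (n : ℝ) ^ (3 * u) := by
      exact_mod_cast card_starsAndPairs_le hn hu
    have h2 := Real.log_le_log (by exact_mod_cast hcard) h1
    rw [Real.log_pow] at h2
    push_cast at h2
    exact h2
  have hadj : ∀ {x y}, (SimpleGraph.fromEdgeSet (X : Set (Sym2 (Fin n)))).Adj x y ↔
      s(x, y) ∈ X := by
    intro x y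
    rw [SimpleGraph.fromEdgeSet_adj, Finset.mem_coe]
    exact ⟨fun h => h.1, fun h => ⟨h, mk_mem_board.1 (hX h)⟩⟩
  refine ⟨X, ⟨SimpleGraph.fromEdgeSet X, ?_, ?_⟩, subset_rfl⟩
  · refine IsJoined.isPancyclic hu ?_ ?_
    · intro U W hUW hU hW
      obtain ⟨U', hU', hUc⟩ := Finset.exists_subset_card_eq hU
      obtain ⟨W', hW', hWc⟩ := Finset.exists_subset_card_eq hW
      have hd := hUW.mono hU' hW'
      have h1 := hshare (edgesBetween U' W') (Finset.mem_union_right _ (Finset.mem_image.2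
        ⟨(U', W'), by simp [Finset.mem_powersetCard, hUc, hWc, hd], rfl⟩))
      rw [edgesBetween_inter_board hd, hUc, hWc, Nat.cast_mul] at h1
      have h2 : (0 : ℝ) < (edgesBetween U' W' ∩ X).card := by linarith
      obtain ⟨e, he⟩ := Finset.card_pos.1 (by exact_mod_cast h2)
      rw [Finset.mem_inter] at he
      obtain ⟨⟨x, y⟩, hxy, rfl⟩ := Finset.mem_image.1 he.1
      rw [Finset.mem_product] at hxy
      exact ⟨x, hU' hxy.1, y, hW' hxy.2, hadj.2 he.2⟩
    · intro v
      refine ⟨({w | s(v, w) ∈ X} : Finset (Fin n)),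
        fun y hy => hadj.2 (Finset.mem_filter.1 hy).2, ?_⟩
      have h1 := hshare (starEdges v) (Finset.mem_union_left _
        (Finset.mem_image_of_mem _ (Finset.mem_univ _)))
      rw [starEdges_inter_board, Nat.cast_sub (by omega), Nat.cast_one] at h1
      have h2 : (20 * u : ℝ) ≤ (starEdges v ∩ X).card := by linarith
      have h3 : starEdges v ∩ X ⊆ ({w | s(v, w) ∈ X} : Finset (Fin n)).image fun w => s(v, w) := by
        intro e he
        rw [Finset.mem_inter] at he
        obtain ⟨w, -, rfl⟩ := Finset.mem_image.1 he.1
        exact Finset.mem_image_of_mem _ (by simpa using he.2)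
      have h4 := (Finset.card_le_card h3).trans Finset.card_image_le
      have h5 : 20 * u ≤ (starEdges v ∩ X).card := by exact_mod_cast h2
      omega
  · ext e
    induction e with | _ x y =>
    rw [SimpleGraph.mem_edgeSet, hadj, Finset.mem_coe]

end MakerFamily

/-! ### Asymptotics -/

section Asymptotics

variable {b : ℕ → ℕ}

/-- This is the only use of `b` being subpolynomial: bounded numbers of stages are negligible. -/
theorem Subpolynomial.tendsto_logb (hb : ∀ n, 1 ≤ b n) (hsub : Subpolynomial b) :
    Tendsto (fun n => Real.logb ((b n : ℝ) + 1) n) atTop atTop := by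
  rw [tendsto_atTop]
  intro T
  set c : ℝ := 1 / (2 * max T 1) with hc
  have hT : 0 < max T 1 := lt_max_of_lt_right one_pos
  have hc₀ : 0 < c := by positivity
  have h2 : ∀ᶠ n : ℕ in atTop, (2 : ℝ) ≤ (n : ℝ) ^ c :=
    ((tendsto_rpow_atTop hc₀).comp tendsto_natCast_atTop_atTop).eventually_ge_atTop 2
  filter_upwards [hsub c hc₀, h2, eventually_ge_atTop 1] with n h1 h2 hn
  have hb' : (1 : ℝ) ≤ b n := by exact_mod_cast hb n
  have hn' : (1 : ℝ) ≤ n := by exact_mod_cast hn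
  have hle : (b n : ℝ) + 1 ≤ (n : ℝ) ^ (2 * c) := by
    rw [two_mul, Real.rpow_add (by linarith)]
    nlinarith
  have hlog := Real.log_le_log (by linarith) hle
  rw [Real.log_rpow (by linarith)] at hlog
  refine (le_max_left T 1).trans ?_
  rw [Real.logb, le_div_iff₀ (Real.log_pos (by linarith))]
  calc max T 1 * Real.log (b n + 1) ≤ max T 1 * (2 * c * Real.log n) := by gcongr
    _ = Real.log n := by rw [hc]; field_simp

/-- The lower bound on the threshold. The `u` of Maker's family is `n ^ (1 / 2 - η / 4)`, while the
shares are at least `n ^ (-1 / 2 + η / 2)`. -/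
theorem eventually_makerCanLast (hb : ∀ n, 1 ≤ b n) {η : ℝ} (hη₀ : 0 < η) (hη₁ : η < 1 / 2) :
    ∀ᶠ n : ℕ in atTop,
      MakerCanLast (PAN n) (b n) ⌊(1 / 2 - η) * Real.logb ((b n : ℝ) + 1) n⌋₊ := by
  -- This choice of `a` makes the loss `(1 - a) ^ 2` per stage equal to `2 ^ (-η)`.
  set a : ℝ := 1 - 2 ^ (-η / 2) with ha
  have ha₁ : a < 1 := by
    have : (0 : ℝ) < 2 ^ (-η / 2) := by positivity
    linarith
  have ha₀ : 0 < a := by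
    have : (2 : ℝ) ^ (-η / 2) < 1 := Real.rpow_lt_one_of_one_lt_of_neg (by norm_num) (by linarith)
    linarith
  have ha2 : (1 - a) ^ 2 = (2 : ℝ) ^ (-η) := by
    rw [ha, sub_sub_cancel, ← Real.rpow_natCast, ← Real.rpow_mul (by norm_num)]
    congr 1
    push_cast
    ring
  have hlog : ∀ᶠ n : ℕ in atTop, 4 * (20 + 6 * Real.log n / a) ≤ (n : ℝ) ^ (η / 4) := by
    have h1 : (fun x : ℝ => 4 * (20 + 6 * Real.log x / a)) =o[atTop] fun x => x ^ (η / 4) := by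
      have h2 := isLittleO_log_rpow_atTop (show 0 < η / 4 by linarith)
      have h3 : (fun _ : ℝ => (80 : ℝ)) =o[atTop] fun x : ℝ => x ^ (η / 4) :=
        Asymptotics.isLittleO_const_left.2
          (Or.inr (tendsto_norm_atTop_atTop.comp (tendsto_rpow_atTop (by linarith))))
      refine (h3.add (h2.const_mul_left (24 / a))).congr_left fun x => ?_
      ring
    have h4 := (h1.comp_tendsto tendsto_natCast_atTop_atTop).bound one_pos
    filter_upwards [h4] with n hn
    simp only [Function.comp_apply, one_mul] at hn
    rw [Real.norm_of_nonneg (Real.rpow_nonneg (Nat.cast_nonneg n) _)] at hn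
    exact (Real.le_norm_self _).trans hn
  filter_upwards [hlog, eventually_ge_atTop 2] with n hlog hn
  set s := ⌊(1 / 2 - η) * Real.logb ((b n : ℝ) + 1) n⌋₊ with hs
  have hx2 : (2 : ℝ) ≤ n := by exact_mod_cast hn
  set x : ℝ := (n : ℝ)
  have hx₀ : 0 < x := by linarith
  have hb' : (1 : ℝ) ≤ b n := by exact_mod_cast hb n
  have hD : ((b n : ℝ) + 1) ^ s ≤ x ^ (1 / 2 - η) := by
    have hL : 0 ≤ Real.logb ((b n : ℝ) + 1) x := Real.logb_nonneg (by linarith) (by linarith)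
    calc ((b n : ℝ) + 1) ^ s = ((b n : ℝ) + 1) ^ (s : ℝ) := (Real.rpow_natCast _ _).symm
      _ ≤ ((b n : ℝ) + 1) ^ ((1 / 2 - η) * Real.logb ((b n : ℝ) + 1) x) :=
        Real.rpow_le_rpow_of_exponent_le (by linarith)
          (Nat.floor_le (mul_nonneg (by linarith) hL))
      _ = x ^ (1 / 2 - η) := by
        rw [mul_comm, Real.rpow_mul (by linarith), Real.rpow_logb (by linarith) (by linarith) hx₀]
  set Q : ℝ := ((1 - a) ^ 2 / ((b n : ℝ) + 1)) ^ s with hQ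
  have hQx : x ^ (-(1 / 2) + η / 2) ≤ Q := by
    have h1 : x ^ (-(η / 2)) ≤ ((1 - a) ^ 2) ^ s := by
      have h2 : (2 : ℝ) ^ s ≤ x ^ (1 / 2 - η) :=
        (pow_le_pow_left₀ (by norm_num) (by linarith) s).trans hD
      calc x ^ (-(η / 2)) ≤ x ^ ((1 / 2 - η) * -η) :=
            Real.rpow_le_rpow_of_exponent_le (by linarith) (by nlinarith)
        _ = (x ^ (1 / 2 - η)) ^ (-η) := Real.rpow_mul hx₀.le _ _
        _ ≤ ((2 : ℝ) ^ s) ^ (-η) :=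
            Real.rpow_le_rpow_of_nonpos (by positivity) h2 (by linarith)
        _ = ((1 - a) ^ 2) ^ s := by
            rw [ha2, ← Real.rpow_natCast, ← Real.rpow_natCast, ← Real.rpow_mul (by norm_num),
              ← Real.rpow_mul (by norm_num), mul_comm]
    rw [hQ, div_pow, le_div_iff₀ (by positivity)]
    calc x ^ (-(1 / 2) + η / 2) * ((b n : ℝ) + 1) ^ s
        ≤ x ^ (-(1 / 2) + η / 2) * x ^ (1 / 2 - η) := by gcongr
      _ = x ^ (-(η / 2)) := by rw [← Real.rpow_add hx₀]; congr 1; ring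
      _ ≤ _ := h1
  set u := ⌈x ^ (1 / 2 - η / 4)⌉₊ with hu
  have hy1 : 1 ≤ x ^ (1 / 2 - η / 4) := Real.one_le_rpow (by linarith) (by linarith)
  have hu1 : x ^ (1 / 2 - η / 4) ≤ u := Nat.le_ceil _
  have hu2 : (u : ℝ) ≤ 2 * x ^ (1 / 2 - η / 4) := by
    have := (Nat.ceil_lt_add_one (show 0 ≤ x ^ (1 / 2 - η / 4) by linarith)).le
    linarith
  have hu₀ : (0 : ℝ) < u := by linarith
  have hlog₀ : 0 ≤ Real.log x / a := div_nonneg (Real.log_nonneg (by linarith)) ha₀.le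
  have hlog' : 6 * Real.log x / a = 6 * (Real.log x / a) := by ring
  rw [hlog'] at hlog
  have hK : 2 * (3 * (u : ℝ) * Real.log x / a) = u * (6 * (Real.log x / a)) := by ring
  refine makerCanLast_pan ha₀ ha₁ (hb n) hn (u := u) (by exact_mod_cast hu₀) ?_ ?_
  · rw [hK]
    calc 20 * (u : ℝ) + u * (6 * (Real.log x / a)) = u * (20 + 6 * (Real.log x / a)) := by ring
      _ ≤ 2 * x ^ (1 / 2 - η / 4) * (x ^ (η / 4) / 4) := by gcongr; linarith
      _ = x ^ (1 / 2 - η / 4 + η / 4) / 2 := by rw [Real.rpow_add hx₀]; ring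
      _ ≤ x ^ (-(1 / 2) + η / 2 + 1) / 2 := by
        have := Real.rpow_le_rpow_of_exponent_le (show 1 ≤ x by linarith)
          (show 1 / 2 - η / 4 + η / 4 ≤ -(1 / 2) + η / 2 + 1 by linarith)
        linarith
      _ = x ^ (-(1 / 2) + η / 2) * (x / 2) := by
        rw [Real.rpow_add hx₀, Real.rpow_one]; ring
      _ ≤ Q * (x - 1) := by gcongr; linarith
  · rw [hK]
    calc (u : ℝ) * (6 * (Real.log x / a)) < u * x ^ (η / 4) := by gcongr; linarith
      _ = u * (x ^ (-(1 / 2) + η / 2) * x ^ (1 / 2 - η / 4)) := by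
        rw [← Real.rpow_add hx₀]; congr 2; ring
      _ ≤ u * (Q * u) := by gcongr
      _ = Q * (u * u) := by ring

/-- The upper bound on the threshold. The size `r` of the dense sets is chosen such that
`n ^ ((1 + η) / 2 * (2 * r - 1))` exceeds `n ^ (r + 2)` by a power of `n`. -/
theorem eventually_le_of_makerCanLast (hb : ∀ n, 1 ≤ b n) (hsub : Subpolynomial b) {η : ℝ}
    (hη : 0 < η) : ∀ᶠ n : ℕ in atTop, ∀ s, MakerCanLast (PAN n) (b n) s →
      (s : ℝ) ≤ (1 / 2 + η) * Real.logb ((b n : ℝ) + 1) n := by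
  obtain ⟨r, hr⟩ := exists_nat_ge (3 / η + 1)
  have hr' : 3 ≤ η / 2 * (2 * r - 1) := by
    have h1 : 3 ≤ (r - 1) * η := by
      rw [← div_le_iff₀ hη]; linarith
    nlinarith
  have hr1 : (1 : ℝ) ≤ r := by
    have : 0 < 3 / η := by positivity
    linarith
  have hC : ∀ᶠ n : ℕ in atTop, (2 : ℝ) ^ (r + 3) ^ 2 < (n : ℝ) ^ (1 / 2 : ℝ) :=
    ((tendsto_rpow_atTop (by norm_num : (0 : ℝ) < 1 / 2)).comp
      tendsto_natCast_atTop_atTop).eventually_gt_atTop _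
  filter_upwards [hC, (hsub.tendsto_logb hb).eventually_ge_atTop (2 * (2 * r + 1) / η),
    eventually_ge_atTop (r + 2)] with n hC hL hn s hs
  set L := Real.logb ((b n : ℝ) + 1) n with hLdef
  have hL₀ : 0 ≤ L := le_trans (by positivity) hL
  rw [div_le_iff₀ hη] at hL
  have hb' : (1 : ℝ) ≤ b n := by exact_mod_cast hb n
  have hx1 : (1 : ℝ) ≤ n := by exact_mod_cast (by omega : 1 ≤ n)
  set x : ℝ := (n : ℝ)
  have hx₀ : 0 < x := by linarith
  set t := ⌈(1 / 2 + η / 2) * L⌉₊ with ht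
  by_contra! hlt
  have ht' : (t : ℝ) < (1 / 2 + η / 2) * L + 1 := Nat.ceil_lt_add_one (by positivity)
  refine not_makerCanLast (hb n) (r := r) (t := t) (by exact_mod_cast hr1) hn ?_ ?_ hs
  · have hD : x ^ (1 / 2 + η / 2) ≤ ((b n : ℝ) + 1) ^ t := by
      calc x ^ (1 / 2 + η / 2) = ((b n : ℝ) + 1) ^ ((1 / 2 + η / 2) * L) := by
            rw [mul_comm, Real.rpow_mul (by linarith), hLdef,
              Real.rpow_logb (by linarith) (by linarith) hx₀]
        _ ≤ ((b n : ℝ) + 1) ^ (t : ℝ) :=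
            Real.rpow_le_rpow_of_exponent_le (by linarith) (Nat.le_ceil _)
        _ = _ := Real.rpow_natCast _ _
    have hDpos : 0 < ((b n : ℝ) + 1) ^ t := by positivity
    set D : ℝ := ((b n : ℝ) + 1) ^ t
    obtain ⟨m, hm⟩ : ∃ m, 2 * r = m + 1 := ⟨2 * r - 1, by
      have : 1 ≤ r := by exact_mod_cast hr1
      omega⟩
    have hm' : (m : ℝ) = 2 * r - 1 := by
      have : ((2 * r : ℕ) : ℝ) = ((m + 1 : ℕ) : ℝ) := by rw [hm]
      push_cast at this
      linarith
    rw [hm, pow_succ]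
    refine mul_lt_mul_of_pos_right ?_ hDpos
    calc x ^ (r + 2) * 2 ^ (r + 3) ^ 2 < x ^ (r + 2) * x ^ (1 / 2 : ℝ) := by gcongr
      _ = x ^ (((r + 2 : ℕ) : ℝ) + 1 / 2) := by rw [Real.rpow_add hx₀, Real.rpow_natCast]
      _ ≤ x ^ ((1 / 2 + η / 2) * m) := by
        refine Real.rpow_le_rpow_of_exponent_le hx1 ?_
        rw [hm']
        push_cast
        linarith
      _ = (x ^ (1 / 2 + η / 2)) ^ m := by rw [Real.rpow_mul hx₀.le, Real.rpow_natCast]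
      _ ≤ D ^ m := by gcongr
  · have : ((t + 2 * r : ℕ) : ℝ) ≤ s := by
      push_cast
      linarith
    exact_mod_cast this

theorem eventually_isGreatest_tau (hb : ∀ n, 1 ≤ b n) (hsub : Subpolynomial b) :
    ∀ᶠ n : ℕ in atTop, IsGreatest {s : ℕ | MakerCanLast (PAN n) (b n) s} (tau (PAN n) (b n)) := by
  filter_upwards [eventually_makerCanLast hb (η := 1 / 4) (by norm_num) (by norm_num),
    eventually_le_of_makerCanLast hb hsub one_pos] with n h1 h2
  have hbdd : BddAbove {s : ℕ | MakerCanLast (PAN n) (b n) s} :=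
    ⟨⌊(1 / 2 + 1) * Real.logb ((b n : ℝ) + 1) n⌋₊, fun s hs => Nat.le_floor (h2 s hs)⟩
  exact ⟨Nat.sSup_mem ⟨_, h1⟩ hbdd, fun s hs => le_csSup hbdd hs⟩

end Asymptotics

end MultistageGame

theorem theorem1p5 (b : ℕ → ℕ) (hb : ∀ n, 1 ≤ b n) (hsub : MultistageGame.Subpolynomial b) :
    (∀ᶠ n : ℕ in atTop,
      IsGreatest {s : ℕ | MultistageGame.MakerCanLast (MultistageGame.PAN n) (b n) s}
        (MultistageGame.tau (MultistageGame.PAN n) (b n))) ∧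
    ∃ ε : ℕ → ℝ, Tendsto ε atTop (𝓝 0) ∧
      ∀ᶠ n : ℕ in atTop,
        (MultistageGame.tau (MultistageGame.PAN n) (b n) : ℝ) =
          (1 / 2 + ε n) * Real.logb ((b n : ℝ) + 1) (n : ℝ) := by
  have hmax := MultistageGame.eventually_isGreatest_tau hb hsub
  have hL := hsub.tendsto_logb hb
  refine ⟨hmax, fun n => (MultistageGame.tau (MultistageGame.PAN n) (b n) : ℝ) /
    Real.logb ((b n : ℝ) + 1) n - 1 / 2, ?_, ?_⟩
  · rw [Metric.tendsto_nhds]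
    intro δ hδ
    obtain ⟨η, hη₀, hη₁, hηδ⟩ : ∃ η : ℝ, 0 < η ∧ η < 1 / 2 ∧ 2 * η < δ :=
      ⟨min (1 / 4) (δ / 4), by positivity, by linarith [min_le_left (1 / 4) (δ / 4)],
        by linarith [min_le_right (1 / 4) (δ / 4)]⟩
    filter_upwards [hmax, MultistageGame.eventually_makerCanLast hb hη₀ hη₁,
      MultistageGame.eventually_le_of_makerCanLast hb hsub hη₀,
      hL.eventually_ge_atTop (1 / η)] with n hmax hlow hup hLη
    set L := Real.logb ((b n : ℝ) + 1) n
    have hL₀ : 0 < L := lt_of_lt_of_le (by positivity) hLη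
    rw [div_le_iff₀ hη₀] at hLη
    have h1 := hup _ hmax.1
    have h2 : ((⌊(1 / 2 - η) * L⌋₊ : ℕ) : ℝ) ≤ MultistageGame.tau (MultistageGame.PAN n) (b n) := by
      exact_mod_cast hmax.2 hlow
    have h3 := Nat.lt_floor_add_one ((1 / 2 - η) * L)
    have h4 : (MultistageGame.tau (MultistageGame.PAN n) (b n) : ℝ) / L ≤ 1 / 2 + η :=
      (div_le_iff₀ hL₀).2 h1
    have h5 : 1 / 2 - 2 * η ≤ (MultistageGame.tau (MultistageGame.PAN n) (b n) : ℝ) / L :=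
      (le_div_iff₀ hL₀).2 (by linarith)
    rw [Real.dist_eq, abs_lt]
    constructor <;> linarith
  · filter_upwards [hL.eventually_gt_atTop 0] with n hn
    field_simp
    ring
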